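/- Label the vertices of a nondegenerate tetrahedron in $\mathbb{R}^3$ by $V_1,V_2,V_3,V_4$ and let $d_{ij}=|V_iV_j|$. A tetrahedron belongs to Goldberg's first family, with parameters $a,b,c$, if $$d_{12}=d_{23}=d_{34}=b,\quad d_{13}=d_{24}=c,\quad d_{14}=a,\qquad \tfrac{a^2}{3}+b^2=c^2 ,$$ and to Goldberg's second family, with parameters $a,b,c,d$, if $$d_{12}=d_{23}=b,\quad d_{13}=c,\quad d_{14}=\tfrac a2,\quad d_{24}=d_{34}=d,\qquad \tfrac{a^2}{12}+d^2=b^2,\quad \tfrac{a^2}{3}+b^2=c^2 .$$ A face-to-face tiling by a tetrahedron $T$ is a set of congruent copies of $T$ (mirror images allowed) that covers $\mathbb{R}^3$, in which distinct tiles have disjoint interiors and any two tiles meet in a common (possibly empty) face. A set of tiles is orientation-preserving if any two of its members are equivalent under an orientation-preserving isometry of $\mathbb{R}^3$. **Proposition 3.2.** For all real $a,b$ with $0<a<3b$ both families have a member with these values of $a,b$. Moreover: 1. Every tetrahedron $T$ of either family admits a face-to-face tiling $\mathcal T$ of $\mathbb{R}^3$. It can be chosen so that there is a tiling of $\mathbb{R}^3$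 by right equilateral triangular prisms, infinitely long in both directions, with the following properties: every tile of $\mathcal T$ lies in one of the prisms; each prism is the union of the tiles that it contains, and these tiles form an orientation-preserving set; and if $\sigma$ is the reflection in the plane of a lateral face of a prism $P$ of the tiling, then $\sigma(P)$ is again a prism of the tiling, and the tiles in $\sigma(P)$ are exactly the images under $\sigma$ of the tiles in $P$. 2. In general reflected copies are needed: if $T$ is in the first family with $a\ne b$ and $a\ne c$, or in the second family with $a\ne 2d$, then no face-to-face tiling of $\mathbb{R}^3$ by $T$ is orientation-preserving. -/

import Mathlib

open Set

/-- Euclidean three-space `ℝ³`. -/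
abbrev E3 : Type := EuclideanSpace ℝ (Fin 3)

/-- A (nondegenerate, vertex-labelled) tetrahedron in `ℝ³`.  The vertices `V₁, V₂, V₃, V₄` are
`T.points 0, T.points 1, T.points 2, T.points 3`. -/
abbrev Tetrahedron : Type := Affine.Simplex ℝ E3 3

namespace Tetrahedron

/-- The solid tetrahedron, as a closed subset of `ℝ³`. -/
def body (T : Tetrahedron) : Set E3 := convexHull ℝ (range T.points)

/-- The edge length `d_{ij}` (with indices starting at `0`). -/
noncomputable def len (T : Tetrahedron) (i j : Fin 4) : ℝ := dist (T.points i) (T.points j)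

/-- `T` is the member of the first Goldberg family with edge lengths
`d₁₂ = d₂₃ = d₃₄ = b`, `d₁₃ = d₂₄ = c`, `d₁₄ = a`, where `a² / 3 + b² = c²`. -/
structure IsGoldbergFirst (a b c : ℝ) (T : Tetrahedron) : Prop where
  rel : a ^ 2 / 3 + b ^ 2 = c ^ 2
  len12 : T.len 0 1 = b
  len13 : T.len 0 2 = c
  len14 : T.len 0 3 = a
  len23 : T.len 1 2 = b
  len24 : T.len 1 3 = c
  len34 : T.len 2 3 = b

/-- `T` is the member of the second Goldberg family with edge lengths
`d₁₂ = d₂₃ = b`, `d₁₃ = c`, `d₁₄ = a / 2`, `d₂₄ = d₃₄ = d`, where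
`a² / 12 + d² = b²` and `a² / 3 + b² = c²`. -/
structure IsGoldbergSecond (a b c d : ℝ) (T : Tetrahedron) : Prop where
  rel₁ : a ^ 2 / 12 + d ^ 2 = b ^ 2
  rel₂ : a ^ 2 / 3 + b ^ 2 = c ^ 2
  len12 : T.len 0 1 = b
  len13 : T.len 0 2 = c
  len14 : T.len 0 3 = a / 2
  len23 : T.len 1 2 = b
  len24 : T.len 1 3 = d
  len34 : T.len 2 3 = d

end Tetrahedron

/-- An isometry of `ℝ³` is orientation-preserving if its linear part has positive determinant. -/
def IsDirectIsometry (φ : E3 ≃ᵃⁱ[ℝ] E3) : Prop :=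
  0 < LinearMap.det (φ.linearIsometryEquiv.toLinearEquiv : E3 →ₗ[ℝ] E3)

/-- Two subsets of `ℝ³` are congruent, mirror images being allowed. -/
def CongruentSets (K L : Set E3) : Prop := ∃ φ : E3 ≃ᵃⁱ[ℝ] E3, φ '' K = L

/-- Two subsets of `ℝ³` are equivalent under an orientation-preserving isometry. -/
def DirectlyCongruent (K L : Set E3) : Prop :=
  ∃ φ : E3 ≃ᵃⁱ[ℝ] E3, IsDirectIsometry φ ∧ φ '' K = L

/-- `F` is a face of the convex set `K`: a convex subset containing both end points of every
segment of `K` that meets it in an interior point of the segment.  For a polytope these are the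
usual faces (vertices, edges, facets, ...), together with `∅` and the polytope itself. -/
def IsFaceOf (F K : Set E3) : Prop := Convex ℝ F ∧ IsExtreme ℝ K F

/-- `𝒯` is a face-to-face tiling of `ℝ³` by congruent copies (possibly reflected) of `T`: the
tiles cover space, distinct tiles have disjoint interiors, and any two tiles meet in a common
(possibly empty) face. -/
structure IsFaceToFaceTiling (T : Tetrahedron) (𝒯 : Set (Set E3)) : Prop where
  congruent : ∀ K ∈ 𝒯, CongruentSets T.body K
  cover : ⋃₀ 𝒯 = univ
  disjoint_interior : ∀ K ∈ 𝒯, ∀ L ∈ 𝒯, K ≠ L → Disjoint (interior K) (interior L)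
  face_to_face : ∀ K ∈ 𝒯, ∀ L ∈ 𝒯, IsFaceOf (K ∩ L) K ∧ IsFaceOf (K ∩ L) L

/-- A tiling is orientation-preserving if any two tiles are equivalent under an
orientation-preserving isometry of `ℝ³`. -/
def IsOrientationPreserving (𝒯 : Set (Set E3)) : Prop :=
  ∀ K ∈ 𝒯, ∀ L ∈ 𝒯, DirectlyCongruent K L

/-- The direction of the line orthogonal to the plane of the triangle `B`. -/
noncomputable def prismAxis (B : Affine.Triangle ℝ E3) : Submodule ℝ E3 :=
  (vectorSpan ℝ (range B.points))ᗮ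

/-- The right prism over the triangle `B`, infinitely long in both directions. -/
def prism (B : Affine.Triangle ℝ E3) : Set E3 :=
  {x | ∃ y ∈ convexHull ℝ (range B.points), ∃ v ∈ prismAxis B, x = y + v}

/-- The plane of the lateral face of `prism B` over the edge of `B` opposite to its vertex `i`. -/
noncomputable def prismWall (B : Affine.Triangle ℝ E3) (i : Fin 3) : AffineSubspace ℝ E3 :=
  AffineSubspace.mk' (B.points (i + 1))
    (Submodule.span ℝ {B.points (i + 2) - B.points (i + 1)} ⊔ prismAxis B)

noncomputable instance (B : Affine.Triangle ℝ E3) (i : Fin 3) : Nonempty (prismWall B i) :=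
  inferInstanceAs (Nonempty (AffineSubspace.mk' _ _))

/-- The orthogonal reflection of `ℝ³` in the plane of a lateral face of `prism B`. -/
noncomputable def prismMirror (B : Affine.Triangle ℝ E3) (i : Fin 3) : E3 ≃ᵃⁱ[ℝ] E3 :=
  EuclideanGeometry.reflection (prismWall B i)

/-- The members of `𝒯` that lie in `P`. -/
def tilesIn (𝒯 : Set (Set E3)) (P : Set E3) : Set (Set E3) := {K ∈ 𝒯 | K ⊆ P}

/-- `𝒯` arises by cutting the infinite equilateral triangular prisms of a tiling of `ℝ³` by such
prisms into pairwise directly congruent pieces, in such a way that the mirror image of a prism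
of the tiling in any of its lateral faces is again a prism of the tiling, cut in the
mirror-image way. -/
def IsAlternatingPrismDissection (𝒯 : Set (Set E3)) : Prop :=
  ∃ 𝒬 : Set (Set E3),
    ⋃₀ 𝒬 = univ ∧
    (∀ P ∈ 𝒬, ∀ Q ∈ 𝒬, P ≠ Q → Disjoint (interior P) (interior Q)) ∧
    (∀ K ∈ 𝒯, ∃ P ∈ 𝒬, K ⊆ P) ∧
    ∀ P ∈ 𝒬,
      ⋃₀ tilesIn 𝒯 P = P ∧
      IsOrientationPreserving (tilesIn 𝒯 P) ∧
      ∃ B : Affine.Triangle ℝ E3, B.Equilateral ∧ P = prism B ∧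
        ∀ i : Fin 3,
          prismMirror B i '' P ∈ 𝒬 ∧
          tilesIn 𝒯 (prismMirror B i '' P) =
            (fun K => prismMirror B i '' K) '' tilesIn 𝒯 P

/-! For the first family, take the edge vectors of the path `V₁V₂V₃V₄` as a basis. The relation `a²
/ 3 + b² = c²` says that they have not only equal lengths but also equal mutual inner products. In
these coordinates the tetrahedron is the Kuhn simplex `1 ≥ x₀ ≥ x₁ ≥ x₂ ≥ 0`, and every coordinate
permutation followed by an integral translation is an isometry. The images under this group form the
Kuhn–Freudenthal triangulation: sorting fractional parts gives covering, and since no wall `xᵢ = k`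
or `xᵢ - xⱼ = k` cuts a tile, tiles meet in faces.

The diagonal `(1,1,1)` is orthogonal to the vectors of coordinate sum zero, so the column `x₂ + 1 ≥
x₀ ≥ x₁ ≥ x₂` is a right prism, with equilateral cross-section. Reflections in its walls swap two
coordinates up to an integral translation and so belong to the group. The tiles inside a column come
from cyclic permutations, which are even.

A tetrahedron of the second family is half of one of the first, cut through `V₂`, `V₃` and the
midpoint of `V₁V₄`, that is, along `x₀ + x₂ = 1`. A half-turn exchanges the two halves, so halving
all tiles gives the second tiling.

For the impossibility, choose a facet with three distinct edge lengths. The neighbour across it is a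
direct copy of the tile glued along a congruent facet. Up to the half-turn symmetry of the first
family, the gluing isometry must fix the facet pointwise. Being direct, it is the identity, so the
neighbour would be the tile itself.

The main lemmas are `exists_symmetricFrame`, `meetsNicely_tetra`, `meetsNicely_half`,
`isDirectIsometry_of_image_subset_column`, `prismMirror_base_mem_group`,
`IsFaceToFaceTiling.exists_neighbour` and `image_body_of_fixes_facet`. -/

/-! ### Convex pieces cut out by affine inequalities -/

/-- `K` and `L` meet in an extreme subset of `K`, and `K` lies in `L` as soon as their interiors
meet. -/
structure MeetsNicely (K L : Set E3) : Prop where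
  isExtreme : IsExtreme ℝ K (K ∩ L)
  subset_of_overlap : ¬ Disjoint (interior K) (interior L) → K ⊆ L

theorem MeetsNicely.univ (K : Set E3) : MeetsNicely K univ :=
  ⟨by rw [inter_univ], fun _ => subset_univ K⟩

theorem not_isOpen_subset_zeroLocus {U : Set E3} (hU : IsOpen U) (hne : U.Nonempty)
    {f : E3 →ᵃ[ℝ] ℝ} (hf : f.linear ≠ 0) : ¬ U ⊆ {x | f x = 0} := by
  intro h
  obtain ⟨x, hx⟩ := hne
  apply hf
  ext v
  have hc : Continuous fun t : ℝ => x + t • v := by fun_prop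
  have hmem : ∀ᶠ t : ℝ in nhds 0, x + t • v ∈ U :=
    hc.continuousAt.eventually_mem (hU.mem_nhds (by simpa using hx))
  have hmem' : ∀ᶠ t : ℝ in nhdsWithin 0 {0}ᶜ, x + t • v ∈ U ∧ t ≠ 0 :=
    (hmem.filter_mono nhdsWithin_le_nhds).and eventually_mem_nhdsWithin
  obtain ⟨t, ht, ht0⟩ := hmem'.exists
  have h1 : f (x + t • v) = 0 := h ht
  have h2 : f x = 0 := h hx
  have h3 : f (x + t • v) = t * f.linear v + f x := by
    have := f.map_vadd x (t • v)
    simpa [add_comm] using this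
  have h4 : t * f.linear v = 0 := by linarith
  simpa [ht0] using h4

/-- The inductive step for adding one inequality at a time. If `f ≥ 0` on `K ∩ L`, nothing is cut
off. If `f ≤ 0` there, what remains is the part where `f` attains its maximum value `0`; this is
extreme, and it has empty interior because `f` is not constant. -/
theorem MeetsNicely.inter_halfSpace {K L : Set E3} (h : MeetsNicely K L) {f : E3 →ᵃ[ℝ] ℝ}
    (hf : f.linear ≠ 0)
    (hs : (∀ x ∈ K ∩ L, 0 ≤ f x) ∨ ∀ x ∈ K ∩ L, f x ≤ 0) :
    MeetsNicely K (L ∩ {x | 0 ≤ f x}) := by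
  constructor
  · refine ⟨inter_subset_left, ?_⟩
    rintro p hp q hq z ⟨hzK, hzL, hz⟩ hseg
    have hpL := h.isExtreme.left_mem_of_mem_openSegment hp hq ⟨hzK, hzL⟩ hseg
    have hqL := h.isExtreme.right_mem_of_mem_openSegment hp hq ⟨hzK, hzL⟩ hseg
    refine ⟨hp, hpL.2, ?_⟩
    rcases hs with hs | hs
    · exact hs p hpL
    · obtain ⟨s, t, hs0, ht0, hst, rfl⟩ := hseg
      have hcomb : f (s • p + t • q) = s * f p + t * f q := by
        simpa using Convex.combo_affine_apply (f := f) (x := p) (y := q) hst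
      have hp' := hs p hpL
      have hq' := hs q hqL
      change 0 ≤ f p
      change 0 ≤ f (s • p + t • q) at hz
      by_contra! hlt
      have := mul_neg_of_pos_of_neg hs0 hlt
      have := mul_nonpos_of_nonneg_of_nonpos ht0.le hq'
      linarith
  · intro hd
    have hKL : K ⊆ L := h.subset_of_overlap fun hdis =>
      hd (hdis.mono_right (interior_mono inter_subset_left))
    rcases hs with hs | hs
    · exact fun x hx => ⟨hKL hx, hs x ⟨hx, hKL hx⟩⟩
    · exfalso
      rw [Set.not_disjoint_iff_nonempty_inter] at hd
      refine not_isOpen_subset_zeroLocus (isOpen_interior.inter isOpen_interior) hd hf ?_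
      rintro x ⟨hxK, hxL⟩
      have hxL' := interior_subset hxL
      have hxK' := interior_subset hxK
      exact le_antisymm (hs x ⟨hxK', hxL'.1⟩) hxL'.2

theorem IsExtreme.image_isometry {A B : Set E3} (h : IsExtreme ℝ A B) (g : E3 ≃ᵃⁱ[ℝ] E3) :
    IsExtreme ℝ (g '' A) (g '' B) := by
  refine ⟨image_mono h.subset, ?_⟩
  rintro _ ⟨p, hp, rfl⟩ _ ⟨q, hq, rfl⟩ _ ⟨z, hz, rfl⟩ hseg
  refine mem_image_of_mem g (h.left_mem_of_mem_openSegment hp hq hz ?_)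
  have h2 : (g : E3 → E3) '' openSegment ℝ p q = openSegment ℝ (g p) (g q) :=
    image_openSegment ℝ (g.toAffineEquiv : E3 →ᵃ[ℝ] E3) p q
  rw [← h2] at hseg
  exact (g.injective.mem_set_image).1 hseg

theorem MeetsNicely.image {K L : Set E3} (h : MeetsNicely K L) (g : E3 ≃ᵃⁱ[ℝ] E3) :
    MeetsNicely (g '' K) (g '' L) := by
  have hint : ∀ S : Set E3, interior (g '' S) = g '' interior S := fun S =>
    (g.toHomeomorph.image_interior S).symm
  constructor
  · rw [← image_inter g.injective]
    exact h.isExtreme.image_isometry g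
  · intro hd
    rw [hint, hint, disjoint_image_iff g.injective] at hd
    exact image_mono (h.subset_of_overlap hd)

/-! ### Frames with a permutation-invariant Gram matrix -/

/-- An affine frame of `ℝ³` whose basis vectors have equal lengths and equal mutual inner
products. -/
structure SymmetricFrame where
  origin : E3
  basis : Module.Basis (Fin 3) ℝ E3
  sq : ℝ
  prod : ℝ
  inner_basis : ∀ i j, inner ℝ (basis i) (basis j) = if i = j then sq else prod

namespace SymmetricFrame

variable (F : SymmetricFrame)

/-- The affine coordinates of a frame. -/
noncomputable def chart : E3 ≃ᵃ[ℝ] (Fin 3 → ℝ) :=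
  (AffineEquiv.vaddConst ℝ F.origin).symm.trans F.basis.equivFun.toAffineEquiv

theorem chart_apply (x : E3) : F.chart x = F.basis.equivFun (x - F.origin) := rfl

theorem chart_sub (x y : E3) : F.chart x - F.chart y = F.basis.equivFun (x - y) := by
  rw [chart_apply, chart_apply, ← map_sub]; congr 1; abel

theorem inner_eq (v w : E3) :
    inner ℝ v w = (F.sq - F.prod) * ∑ i, F.basis.equivFun v i * F.basis.equivFun w i
      + F.prod * ((∑ i, F.basis.equivFun v i) * ∑ i, F.basis.equivFun w i) := by
  conv_lhs => rw [← F.basis.sum_equivFun v, ← F.basis.sum_equivFun w]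
  simp only [Fin.sum_univ_three, inner_add_left, inner_add_right, real_inner_smul_left,
    real_inner_smul_right, F.inner_basis]
  simp
  ring

theorem prod_lt_sq : F.prod < F.sq := by
  have h : (0 : ℝ) < inner ℝ (F.basis 0 - F.basis 1) (F.basis 0 - F.basis 1) := by
    rw [real_inner_self_pos, sub_ne_zero]
    exact F.basis.injective.ne (by decide)
  simp only [inner_sub_left, inner_sub_right, F.inner_basis] at h
  simp at h
  linarith

theorem dist_sq_eq (x y : E3) :
    dist x y ^ 2 = (F.sq - F.prod) * ∑ i, (F.chart x i - F.chart y i) ^ 2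
      + F.prod * (∑ i, (F.chart x i - F.chart y i)) ^ 2 := by
  rw [dist_eq_norm, ← real_inner_self_eq_norm_sq, F.inner_eq, ← F.chart_sub]
  simp [pow_two]

/-- Distances depend only on the sum of squares and the squared sum of the coordinate differences,
and both ignore permutations and a global sign. The sign `-1` is needed only for the half-turn. -/
theorem exists_isometry (ε : ℝ) (hε : ε * ε = 1) (n : Fin 3 → ℝ) (σ : Equiv.Perm (Fin 3)) :
    ∃ g : E3 ≃ᵃⁱ[ℝ] E3, ∀ x i, F.chart (g x) i = n i + ε * F.chart x (σ i) := by
  let e : E3 ≃ E3 :=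
    { toFun := fun x => F.chart.symm fun i => n i + ε * F.chart x (σ i)
      invFun := fun y => F.chart.symm fun i => ε * (F.chart y (σ.symm i) - n (σ.symm i))
      left_inv := fun x => by
        apply F.chart.injective
        ext i
        simp [← mul_assoc, hε]
      right_inv := fun x => by
        apply F.chart.injective
        ext i
        simp [← mul_assoc, hε] }
  have he : ∀ x i, F.chart (e x) i = n i + ε * F.chart x (σ i) := fun x i => by simp [e]
  have hiso : Isometry e := by
    refine Isometry.of_dist_eq fun x y => ?_
    have h2 : dist (e x) (e y) ^ 2 = dist x y ^ 2 := by
      rw [F.dist_sq_eq, F.dist_sq_eq]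
      have h1 : ∀ i, F.chart (e x) i - F.chart (e y) i
          = ε * (F.chart x (σ i) - F.chart y (σ i)) := fun i => by rw [he, he]; ring
      simp only [h1, mul_pow, ← Finset.mul_sum]
      rw [Equiv.sum_comp σ (fun i => (F.chart x i - F.chart y i) ^ 2),
        Equiv.sum_comp σ (fun i => F.chart x i - F.chart y i), pow_two ε, hε]
      ring
    exact (pow_left_inj₀ dist_nonneg dist_nonneg two_ne_zero).1 h2
  exact ⟨(IsometryEquiv.mk e hiso).toRealAffineIsometryEquiv, he⟩

theorem det_eq {g : E3 ≃ᵃⁱ[ℝ] E3} {ε : ℝ} {n : Fin 3 → ℝ} {σ : Equiv.Perm (Fin 3)}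
    (hg : ∀ x i, F.chart (g x) i = n i + ε * F.chart x (σ i)) :
    LinearMap.det (g.linearIsometryEquiv.toLinearEquiv : E3 →ₗ[ℝ] E3)
      = ε ^ 3 * (Equiv.Perm.sign σ : ℤ) := by
  have hlin : ∀ v i, F.basis.equivFun (g.linearIsometryEquiv v) i
      = ε * F.basis.equivFun v (σ i) := by
    intro v i
    have h1 : g.linearIsometryEquiv v = g (v + F.origin) - g F.origin := by
      have := g.map_vadd F.origin v
      simp only [vadd_eq_add] at this
      rw [this]; abel
    have h2 : F.basis.equivFun v = F.chart (v + F.origin) - F.chart F.origin := by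
      rw [F.chart_sub]; simp
    rw [h1, ← F.chart_sub, h2, Pi.sub_apply, Pi.sub_apply, hg, hg]
    ring
  rw [← LinearMap.det_conj _ F.basis.equivFun]
  have : (F.basis.equivFun : E3 →ₗ[ℝ] (Fin 3 → ℝ)) ∘ₗ
      (g.linearIsometryEquiv.toLinearEquiv : E3 →ₗ[ℝ] E3) ∘ₗ
      (F.basis.equivFun.symm : (Fin 3 → ℝ) →ₗ[ℝ] E3)
      = ε • Matrix.toLin' (σ.permMatrix ℝ) := by
    apply LinearMap.ext
    intro c
    ext i
    have := hlin (F.basis.equivFun.symm c) i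
    simp only [LinearEquiv.apply_symm_apply] at this
    simp only [LinearMap.comp_apply, LinearMap.smul_apply, Matrix.toLin'_apply,
      Matrix.permMatrix_mulVec, Pi.smul_apply, smul_eq_mul, Function.comp_apply]
    exact this
  rw [this, LinearMap.det_smul, LinearMap.det_toLin', Matrix.det_permutation]
  simp

end SymmetricFrame

theorem perm_fin_three_cases (σ : Equiv.Perm (Fin 3)) :
    (σ 0 = 0 ∧ σ 1 = 1 ∧ σ 2 = 2) ∨ (σ 0 = 0 ∧ σ 1 = 2 ∧ σ 2 = 1) ∨
    (σ 0 = 1 ∧ σ 1 = 0 ∧ σ 2 = 2) ∨ (σ 0 = 1 ∧ σ 1 = 2 ∧ σ 2 = 0) ∨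
    (σ 0 = 2 ∧ σ 1 = 0 ∧ σ 2 = 1) ∨ (σ 0 = 2 ∧ σ 1 = 1 ∧ σ 2 = 0) := by
  revert σ; decide

/-- A wall function on a tile is an integer plus a quantity in `[-1, 1]` of constant sign, so these
three cases decide its sign. -/
theorem int_sign_cases (k : ℤ) : (k : ℝ) ≤ -1 ∨ (k : ℝ) = 0 ∨ 1 ≤ (k : ℝ) := by
  have : k ≤ -1 ∨ k = 0 ∨ 1 ≤ k := by omega
  exact_mod_cast this

/-! ### The Kuhn simplex, the column and the group of integral isometries -/

namespace SymmetricFrame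

variable (F : SymmetricFrame)

/-- The affine function `p x₀ + q x₁ + r x₂ + s` of the coordinates. -/
noncomputable def form (p q r s : ℝ) : E3 →ᵃ[ℝ] ℝ :=
  ((p • LinearMap.proj 0 + q • LinearMap.proj 1 + r • LinearMap.proj 2 :
      (Fin 3 → ℝ) →ₗ[ℝ] ℝ).toAffineMap + AffineMap.const ℝ (Fin 3 → ℝ) s).comp
    (F.chart : E3 →ᵃ[ℝ] (Fin 3 → ℝ))

theorem form_apply (p q r s : ℝ) (x : E3) :
    F.form p q r s x = p * F.chart x 0 + q * F.chart x 1 + r * F.chart x 2 + s := by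
  simp [form]

theorem form_linear_ne_zero {p q r : ℝ} (h : p ≠ 0 ∨ q ≠ 0 ∨ r ≠ 0) (s : ℝ) :
    (F.form p q r s).linear ≠ 0 := by
  intro h0
  have h1 := (F.form p q r s).linearMap_vsub (F.chart.symm ![p, q, r]) (F.chart.symm 0)
  rw [h0] at h1
  simp [form_apply] at h1
  have h2 := sq_nonneg p
  have h3 := sq_nonneg q
  have h4 := sq_nonneg r
  rcases h with h | h | h <;> have := sq_pos_of_ne_zero h <;> nlinarith

/-- The tetrahedron `1 ≥ x₀ ≥ x₁ ≥ x₂ ≥ 0`. -/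
def tetra : Set E3 :=
  {x | 0 ≤ F.chart x 2 ∧ F.chart x 2 ≤ F.chart x 1 ∧ F.chart x 1 ≤ F.chart x 0 ∧ F.chart x 0 ≤ 1}

/-- The infinite prism `x₂ + 1 ≥ x₀ ≥ x₁ ≥ x₂`. -/
def column : Set E3 :=
  {x | F.chart x 2 ≤ F.chart x 1 ∧ F.chart x 1 ≤ F.chart x 0 ∧ F.chart x 0 ≤ F.chart x 2 + 1}

theorem tetra_subset_column : F.tetra ⊆ F.column := fun _ hx =>
  ⟨hx.2.1, hx.2.2.1, by linarith [hx.1, hx.2.2.2]⟩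

/-- The isometries acting on the coordinates by a permutation followed by an integral
translation. -/
def group : Subgroup (E3 ≃ᵃⁱ[ℝ] E3) where
  carrier := {g | ∃ (n : Fin 3 → ℤ) (σ : Equiv.Perm (Fin 3)),
    ∀ x i, F.chart (g x) i = n i + F.chart x (σ i)}
  one_mem' := ⟨0, 1, fun x i => by simp⟩
  mul_mem' := by
    rintro g g' ⟨n, σ, h⟩ ⟨m, τ, h'⟩
    refine ⟨fun i => n i + m (σ i), σ.trans τ, fun x i => ?_⟩
    rw [AffineIsometryEquiv.coe_mul, Function.comp_apply, h, h']
    push_cast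
    simp [add_assoc]
  inv_mem' := by
    rintro g ⟨n, σ, h⟩
    refine ⟨fun i => - n (σ.symm i), σ.symm, fun x i => ?_⟩
    have := h (g⁻¹ x) (σ.symm i)
    rw [← Function.comp_apply (f := g), ← AffineIsometryEquiv.coe_mul, mul_inv_cancel] at this
    simp at this ⊢
    linarith

theorem exists_mem_group (n : Fin 3 → ℤ) (σ : Equiv.Perm (Fin 3)) :
    ∃ g ∈ F.group, ∀ x i, F.chart (g x) i = n i + F.chart x (σ i) := by
  obtain ⟨g, hg⟩ := F.exists_isometry 1 (by norm_num) (fun i => n i) σ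
  simp only [one_mul] at hg
  exact ⟨g, ⟨n, σ, hg⟩, hg⟩

theorem meetsNicely_image_inter_form {K L : Set E3} {g : E3 ≃ᵃⁱ[ℝ] E3} {p q r s : ℝ}
    (hne : p ≠ 0 ∨ q ≠ 0 ∨ r ≠ 0) (hL : MeetsNicely (g '' K) L)
    (h : (∀ y ∈ K, 0 ≤ F.form p q r s (g y)) ∨ (∀ y ∈ K, F.form p q r s (g y) ≤ 0)) :
    MeetsNicely (g '' K) (L ∩ {x | 0 ≤ F.form p q r s x}) := by
  refine hL.inter_halfSpace (F.form_linear_ne_zero hne s) ?_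
  rcases h with h | h
  · left; rintro _ ⟨⟨y, hy, rfl⟩, -⟩; exact h y hy
  · right; rintro _ ⟨⟨y, hy, rfl⟩, -⟩; exact h y hy

theorem meetsNicely_tetra {K : Set E3} {g : E3 ≃ᵃⁱ[ℝ] E3} (hg : g ∈ F.group)
    (hK : K ⊆ F.tetra) : MeetsNicely (g '' K) F.tetra := by
  obtain ⟨n, σ, hσ⟩ := hg
  have hset : F.tetra = (((univ ∩ {x | 0 ≤ F.form 0 0 1 0 x}) ∩ {x | 0 ≤ F.form 0 1 (-1) 0 x})
      ∩ {x | 0 ≤ F.form 1 (-1) 0 0 x}) ∩ {x | 0 ≤ F.form (-1) 0 0 1 x} := by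
    ext x
    simp only [tetra, form_apply, mem_inter_iff, mem_univ, true_and, mem_ofPred_eq]
    constructor
    · rintro ⟨h1, h2, h3, h4⟩; exact ⟨⟨⟨by linarith, by linarith⟩, by linarith⟩, by linarith⟩
    · rintro ⟨⟨⟨h1, h2⟩, h3⟩, h4⟩; exact ⟨by linarith, by linarith, by linarith, by linarith⟩
  rw [hset]
  refine F.meetsNicely_image_inter_form (by simp) (F.meetsNicely_image_inter_form (by simp)
    (F.meetsNicely_image_inter_form (by simp)
    (F.meetsNicely_image_inter_form (by simp) (MeetsNicely.univ _) ?_) ?_) ?_) ?_ <;>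
    simp only [form_apply, hσ]
  · rcases perm_fin_three_cases σ with h | h | h | h | h | h <;> obtain ⟨h0, h1, h2⟩ := h <;>
      rw [h0, h1, h2] <;>
      rcases int_sign_cases (n 2) with hk | hk | hk <;>
      first
      | (left; intro y hy; obtain ⟨a1, a2, a3, a4⟩ := hK hy; linarith)
      | (right; intro y hy; obtain ⟨a1, a2, a3, a4⟩ := hK hy; linarith)
  · rcases perm_fin_three_cases σ with h | h | h | h | h | h <;> obtain ⟨h0, h1, h2⟩ := h <;>
      rw [h0, h1, h2] <;>
      rcases int_sign_cases (n 1 - n 2) with hk | hk | hk <;> push_cast at hk <;>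
      first
      | (left; intro y hy; obtain ⟨a1, a2, a3, a4⟩ := hK hy; linarith)
      | (right; intro y hy; obtain ⟨a1, a2, a3, a4⟩ := hK hy; linarith)
  · rcases perm_fin_three_cases σ with h | h | h | h | h | h <;> obtain ⟨h0, h1, h2⟩ := h <;>
      rw [h0, h1, h2] <;>
      rcases int_sign_cases (n 0 - n 1) with hk | hk | hk <;> push_cast at hk <;>
      first
      | (left; intro y hy; obtain ⟨a1, a2, a3, a4⟩ := hK hy; linarith)
      | (right; intro y hy; obtain ⟨a1, a2, a3, a4⟩ := hK hy; linarith)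
  · rcases perm_fin_three_cases σ with h | h | h | h | h | h <;> obtain ⟨h0, h1, h2⟩ := h <;>
      rw [h0, h1, h2] <;>
      rcases int_sign_cases (n 0 - 1) with hk | hk | hk <;> push_cast at hk <;>
      first
      | (left; intro y hy; obtain ⟨a1, a2, a3, a4⟩ := hK hy; linarith)
      | (right; intro y hy; obtain ⟨a1, a2, a3, a4⟩ := hK hy; linarith)

theorem meetsNicely_column {g : E3 ≃ᵃⁱ[ℝ] E3} (hg : g ∈ F.group) :
    MeetsNicely (g '' F.column) F.column := by
  obtain ⟨n, σ, hσ⟩ := hg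
  have hset : F.column = ((univ ∩ {x | 0 ≤ F.form 0 1 (-1) 0 x})
      ∩ {x | 0 ≤ F.form 1 (-1) 0 0 x}) ∩ {x | 0 ≤ F.form (-1) 0 1 1 x} := by
    ext x
    simp only [column, form_apply, mem_inter_iff, mem_univ, true_and, mem_ofPred_eq]
    constructor
    · rintro ⟨h1, h2, h3⟩; exact ⟨⟨by linarith, by linarith⟩, by linarith⟩
    · rintro ⟨⟨h1, h2⟩, h3⟩; exact ⟨by linarith, by linarith, by linarith⟩
  conv_rhs => rw [hset]
  refine F.meetsNicely_image_inter_form (by simp) (F.meetsNicely_image_inter_form (by simp)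
    (F.meetsNicely_image_inter_form (by simp)
    (MeetsNicely.univ _) ?_) ?_) ?_ <;>
    simp only [form_apply, hσ]
  · rcases perm_fin_three_cases σ with h | h | h | h | h | h <;> obtain ⟨h0, h1, h2⟩ := h <;>
      rw [h0, h1, h2] <;>
      rcases int_sign_cases (n 1 - n 2) with hk | hk | hk <;> push_cast at hk <;>
      first
      | (left; rintro y ⟨a1, a2, a3⟩; linarith)
      | (right; rintro y ⟨a1, a2, a3⟩; linarith)
  · rcases perm_fin_three_cases σ with h | h | h | h | h | h <;> obtain ⟨h0, h1, h2⟩ := h <;>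
      rw [h0, h1, h2] <;>
      rcases int_sign_cases (n 0 - n 1) with hk | hk | hk <;> push_cast at hk <;>
      first
      | (left; rintro y ⟨a1, a2, a3⟩; linarith)
      | (right; rintro y ⟨a1, a2, a3⟩; linarith)
  · rcases perm_fin_three_cases σ with h | h | h | h | h | h <;> obtain ⟨h0, h1, h2⟩ := h <;>
      rw [h0, h1, h2] <;>
      rcases int_sign_cases (n 0 - n 2 - 1) with hk | hk | hk <;> push_cast at hk <;>
      first
      | (left; rintro y ⟨a1, a2, a3⟩; linarith)
      | (right; rintro y ⟨a1, a2, a3⟩; linarith)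

/-- The part of `tetra` on one side of the plane `x₀ + x₂ = 1`. -/
def half (ε : ℝ) : Set E3 := F.tetra ∩ {x | 0 ≤ F.form (-ε) 0 (-ε) ε x}

theorem mem_half {ε : ℝ} {x : E3} :
    x ∈ F.half ε ↔ x ∈ F.tetra ∧ 0 ≤ ε * (1 - F.chart x 0 - F.chart x 2) := by
  simp only [half, form_apply, mem_inter_iff, mem_ofPred_eq]
  ring_nf

/-- The plane `x₀ + x₂ = 1` is not a wall of the group, so it is tested only on the part of the tile
inside `tetra`. A translation entry at least `1` forces `x₀ = 1` there, and one at most `-1` forces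
`x₂ = 0`; either fixes the side. -/
theorem meetsNicely_half {g : E3 ≃ᵃⁱ[ℝ] E3} (hg : g ∈ F.group) {ε ε' : ℝ}
    (hε : ε = 1 ∨ ε = -1) (hε' : ε' = 1 ∨ ε' = -1) :
    MeetsNicely (g '' F.half ε') (F.half ε) := by
  have hne : ε ≠ 0 := by rcases hε with rfl | rfl <;> norm_num
  refine (F.meetsNicely_tetra hg inter_subset_left).inter_halfSpace
    (F.form_linear_ne_zero (by simp [hne]) _) ?_
  have key : (∀ x ∈ g '' F.half ε' ∩ F.tetra, 0 ≤ 1 - F.chart x 0 - F.chart x 2) ∨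
      (∀ x ∈ g '' F.half ε' ∩ F.tetra, 1 - F.chart x 0 - F.chart x 2 ≤ 0) := by
    obtain ⟨n, σ, hσ⟩ := hg
    by_cases h1 : ∃ i, 1 ≤ n i
    · obtain ⟨i, hi⟩ := h1
      right
      rintro _ ⟨⟨y, hy, rfl⟩, b1, b2, b3, b4⟩
      obtain ⟨a1, a2, a3, a4⟩ := (F.mem_half.1 hy).1
      have hi' : (1 : ℝ) ≤ n i := by exact_mod_cast hi
      have hpos : ∀ j, 0 ≤ F.chart y j := by
        intro j; fin_cases j <;> simp <;> linarith
      have hle : F.chart (g y) i ≤ F.chart (g y) 0 := by fin_cases i <;> simp <;> linarith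
      have := hσ y i
      linarith [hpos (σ i)]
    by_cases h2 : ∃ i, n i ≤ -1
    · obtain ⟨i, hi⟩ := h2
      left
      rintro _ ⟨⟨y, hy, rfl⟩, b1, b2, b3, b4⟩
      obtain ⟨a1, a2, a3, a4⟩ := (F.mem_half.1 hy).1
      have hi' : (n i : ℝ) ≤ -1 := by exact_mod_cast hi
      have hpos : ∀ j, F.chart y j ≤ 1 := by
        intro j; fin_cases j <;> simp <;> linarith
      have hle : F.chart (g y) 2 ≤ F.chart (g y) i := by fin_cases i <;> simp <;> linarith
      have := hσ y i
      linarith [hpos (σ i)]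
    · push Not at h1 h2
      have hn : ∀ i, n i = 0 := fun i => by have := h1 i; have := h2 i; omega
      -- With no translation, the coordinates are in decreasing order both before and after the
      -- permutation, hence unchanged: the point stays on its own side.
      have hsum : ∀ x ∈ g '' F.half ε' ∩ F.tetra,
          0 ≤ ε' * (1 - F.chart x 0 - F.chart x 2) := by
        rintro _ ⟨⟨y, hy, rfl⟩, b1, b2, b3, b4⟩
        obtain ⟨⟨a1, a2, a3, a4⟩, a5⟩ := F.mem_half.1 hy
        simp only [hσ, hn, Int.cast_zero, zero_add] at b1 b2 b3 b4 ⊢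
        rcases perm_fin_three_cases σ with h | h | h | h | h | h <;> obtain ⟨h0, h1, h2⟩ := h <;>
          simp only [h0, h1, h2] at b1 b2 b3 b4 ⊢ <;> rcases hε' with rfl | rfl <;> linarith
      rcases hε' with rfl | rfl
      · left; intro x hx; linarith [hsum x hx]
      · right; intro x hx; linarith [hsum x hx]
  simp only [form_apply]
  rcases hε with rfl | rfl <;> rcases key with h | h
  · left; intro x hx; linarith [h x hx]
  · right; intro x hx; linarith [h x hx]
  · right; intro x hx; linarith [h x hx]
  · left; intro x hx; linarith [h x hx]

theorem exists_mem_image_tetra (x : E3) : ∃ g ∈ F.group, x ∈ g '' F.tetra := by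
  set y : Fin 3 → ℝ := fun i => Int.fract (F.chart x i) with hy
  have hy0 : ∀ i, 0 ≤ y i := fun i => Int.fract_nonneg _
  have hy1 : ∀ i, y i ≤ 1 := fun i => (Int.fract_lt_one _).le
  -- `Tuple.sort` sorts increasingly; the reversal turns this into the decreasing order of `tetra`.
  obtain ⟨τ, h1, h2⟩ : ∃ τ : Equiv.Perm (Fin 3), y (τ 1) ≤ y (τ 0) ∧ y (τ 2) ≤ y (τ 1) := by
    refine ⟨Fin.revPerm.trans (Tuple.sort y), ?_, ?_⟩ <;>
      exact Tuple.monotone_sort y (by decide)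
  obtain ⟨g, hg, hgx⟩ := F.exists_mem_group (fun i => ⌊F.chart x i⌋) τ.symm
  refine ⟨g, hg, F.chart.symm (y ∘ τ), ⟨?_, ?_, ?_, ?_⟩, ?_⟩
  · simpa using hy0 _
  · simpa using h2
  · simpa using h1
  · simpa using hy1 _
  · apply F.chart.injective
    ext i
    rw [hgx]
    simp [hy, Int.floor_add_fract]

/-- The column is a stack of tetrahedra permuted by the screw motion `(x₀, x₁, x₂) ↦ (x₂ + 1, x₀,
x₁)`. Its cube is translation by `(1,1,1)`, so the integer part of `x₂` and the number of other
coordinates exceeding it by more than `1` select the layer. -/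
theorem exists_image_tetra_subset_column {x : E3} (hx : x ∈ F.column) :
    ∃ g ∈ F.group, g '' F.tetra ⊆ F.column ∧ x ∈ g '' F.tetra := by
  have main : ∀ (n : Fin 3 → ℤ) (σ : Equiv.Perm (Fin 3)),
      (∀ y ∈ F.tetra, F.chart.symm (fun i => n i + F.chart y (σ i)) ∈ F.column) →
      F.chart.symm (fun i => F.chart x (σ.symm i) - n (σ.symm i)) ∈ F.tetra →
      ∃ g ∈ F.group, g '' F.tetra ⊆ F.column ∧ x ∈ g '' F.tetra := by
    intro n σ h1 h2
    obtain ⟨g, hg, hgx⟩ := F.exists_mem_group n σ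
    refine ⟨g, hg, ?_, _, h2, ?_⟩
    · rintro _ ⟨y, hy, rfl⟩
      have : g y = F.chart.symm (fun i => n i + F.chart y (σ i)) := by
        apply F.chart.injective; ext i; simp [hgx]
      rw [this]; exact h1 y hy
    · apply F.chart.injective; ext i; rw [hgx]; simp
  obtain ⟨b1, b2, b3⟩ := hx
  have f1 := Int.floor_le (F.chart x 2)
  have f2 := Int.lt_floor_add_one (F.chart x 2)
  set k := ⌊F.chart x 2⌋
  by_cases c1 : F.chart x 0 ≤ k + 1
  · refine main (fun _ => k) (Equiv.refl _) ?_ ?_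
    · rintro y ⟨a1, a2, a3, a4⟩
      refine ⟨?_, ?_, ?_⟩ <;> simp <;> linarith
    · refine ⟨?_, ?_, ?_, ?_⟩ <;> simp <;> linarith
  by_cases c2 : F.chart x 1 ≤ k + 1
  · refine main ![k + 1, k, k] ⟨![2, 0, 1], ![1, 2, 0], by decide, by decide⟩ ?_ ?_
    · rintro y ⟨a1, a2, a3, a4⟩
      refine ⟨?_, ?_, ?_⟩ <;> simp <;> linarith
    · refine ⟨?_, ?_, ?_, ?_⟩ <;> simp <;> linarith
  · refine main ![k + 1, k + 1, k] ⟨![1, 2, 0], ![2, 0, 1], by decide, by decide⟩ ?_ ?_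
    · rintro y ⟨a1, a2, a3, a4⟩
      refine ⟨?_, ?_, ?_⟩ <;> simp <;> linarith
    · refine ⟨?_, ?_, ?_, ?_⟩ <;> simp <;> linarith

/-- The vertices of `tetra`. -/
noncomputable def vertex (k : Fin 4) : E3 :=
  F.chart.symm (![![0, 0, 0], ![1, 0, 0], ![1, 1, 0], ![1, 1, 1]] k)

theorem chart_vertex (k : Fin 4) : F.chart (F.vertex k) =
    ![![0, 0, 0], ![1, 0, 0], ![1, 1, 0], ![1, 1, 1]] k := by
  simp [vertex]

/-- Vertices 1 and 2 belong to both halves of `tetra`, while vertices 0 and 3 differ by the axis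
vector `(1,1,1)`, so either one yields the same inequalities on `n`. Together these integer
inequalities leave only cyclic `σ`. -/
theorem isDirectIsometry_of_image_subset_column {K : Set E3} {g : E3 ≃ᵃⁱ[ℝ] E3}
    (hg : g ∈ F.group) (h1 : F.vertex 1 ∈ K) (h2 : F.vertex 2 ∈ K)
    (h03 : F.vertex 0 ∈ K ∨ F.vertex 3 ∈ K) (hK : g '' K ⊆ F.column) : IsDirectIsometry g := by
  obtain ⟨n, σ, hσ⟩ := hg
  have hd := F.det_eq (g := g) (ε := 1) (n := fun i => n i) (σ := σ) (by simpa using hσ)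
  suffices hs : Equiv.Perm.sign σ = 1 by
    rw [IsDirectIsometry, hd, hs]; norm_num
  have hv0 : ∀ i, F.chart (F.vertex 0) i = 0 := fun i => by
    rw [F.chart_vertex]; fin_cases i <;> simp
  have hv1 : ∀ i, F.chart (F.vertex 1) i = ((if i = 0 then 1 else 0 : ℤ) : ℝ) := fun i => by
    rw [F.chart_vertex]; fin_cases i <;> simp
  have hv2 : ∀ i, F.chart (F.vertex 2) i = ((if i = 2 then 0 else 1 : ℤ) : ℝ) := fun i => by
    rw [F.chart_vertex]; fin_cases i <;> simp
  have hv3 : ∀ i, F.chart (F.vertex 3) i = 1 := fun i => by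
    rw [F.chart_vertex]; fin_cases i <;> simp
  obtain ⟨a1, a2, a3⟩ := hK (mem_image_of_mem g h1)
  obtain ⟨b1, b2, b3⟩ := hK (mem_image_of_mem g h2)
  obtain ⟨c1, c2, c3⟩ : (n 2 : ℝ) ≤ n 1 ∧ (n 1 : ℝ) ≤ n 0 ∧ (n 0 : ℝ) ≤ n 2 + 1 := by
    rcases h03 with h | h <;> obtain ⟨c1, c2, c3⟩ := hK (mem_image_of_mem g h) <;>
      simp only [hσ, hv0, hv3] at c1 c2 c3 <;> refine ⟨?_, ?_, ?_⟩ <;> linarith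
  simp only [hσ, hv1, hv2] at a1 a2 a3 b1 b2 b3
  clear hσ hd hv0 hv1 hv2 hv3
  norm_cast at a1 a2 a3 b1 b2 b3 c1 c2 c3
  have hsig : ∀ τ : Equiv.Perm (Fin 3),
      (τ 0 = 0 ∧ τ 1 = 1) ∨ (τ 0 = 1 ∧ τ 1 = 2) ∨ (τ 0 = 2 ∧ τ 1 = 0) → Equiv.Perm.sign τ = 1 := by
    decide
  apply hsig
  rcases perm_fin_three_cases σ with h | h | h | h | h | h <;> obtain ⟨h0, h1, h2⟩ := h <;>
    simp only [h0, h1, h2] at a1 a2 a3 b1 b2 b3 ⊢ <;> simp at a1 a2 a3 b1 b2 b3 ⊢ <;> omega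

end SymmetricFrame

/-! ### The column as an equilateral prism, and its mirrors -/

theorem affineIndependent_of_sum_smul {ι : Type*} [Fintype ι] {p : ι → E3}
    (h : ∀ w : ι → ℝ, ∑ i, w i = 0 → ∑ i, w i • p i = 0 → ∀ i, w i = 0) :
    AffineIndependent ℝ p := by
  rw [affineIndependent_iff_of_fintype]
  intro w hw hw'
  rw [Finset.weightedVSub_eq_linear_combination _ hw] at hw'
  exact h w hw hw'

theorem reflection_eq_of_midpoint_mem {s : AffineSubspace ℝ E3} [Nonempty s] {p q : E3}
    (hm : midpoint ℝ p q ∈ s) (ho : q - p ∈ s.directionᗮ) :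
    EuclideanGeometry.reflection s p = q := by
  have hproj : (EuclideanGeometry.orthogonalProjection s p : E3) = midpoint ℝ p q := by
    rw [EuclideanGeometry.coe_orthogonalProjection_eq_iff_mem]
    refine ⟨hm, ?_⟩
    rw [vsub_eq_sub, show p - midpoint ℝ p q = (-(1 / 2) : ℝ) • (q - p) by
      rw [midpoint_eq_smul_add, invOf_eq_inv]; module]
    exact Submodule.smul_mem _ _ ho
  rw [EuclideanGeometry.reflection_apply', hproj]
  simp only [vsub_eq_sub, vadd_eq_add, midpoint_eq_smul_add, invOf_eq_inv]
  module

namespace SymmetricFrame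

variable (F : SymmetricFrame)

theorem chart_combo {s t : ℝ} (hst : s + t = 1) (x y : E3) (i : Fin 3) :
    F.chart (s • x + t • y) i = s * F.chart x i + t * F.chart y i := by
  have := Convex.combo_affine_apply (f := (F.chart : E3 →ᵃ[ℝ] (Fin 3 → ℝ))) (x := x) (y := y) hst
  simpa using congrFun this i

theorem chart_sum {ι : Type*} [Fintype ι] {w : ι → ℝ} (hw : ∑ j, w j = 1) (p : ι → E3)
    (i : Fin 3) : F.chart (∑ j, w j • p j) i = ∑ j, w j * F.chart (p j) i := by
  have h : ∑ j, w j • p j - F.origin = ∑ j, w j • (p j - F.origin) := by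
    simp only [smul_sub, Finset.sum_sub_distrib, ← Finset.sum_smul, hw, one_smul]
  simp [chart_apply, h, Finset.sum_apply]

theorem convex_column : Convex ℝ F.column := by
  rintro x ⟨a1, a2, a3⟩ y ⟨b1, b2, b3⟩ s t hs ht hst
  refine ⟨?_, ?_, ?_⟩ <;> simp only [F.chart_combo hst] <;> nlinarith

/-- The orthogonal cross-section of `column` through the origin of the frame. -/
noncomputable def base : Affine.Triangle ℝ E3 where
  -- Orthogonal projections of the simplex vertices along `(1,1,1)` onto coordinate sum zero;
  -- vertices 0 and 3 project to the same point.
  points (i : Fin 3) := F.chart.symm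
    (![![0, 0, 0], ![2 / 3, -1 / 3, -1 / 3], ![1 / 3, 1 / 3, -2 / 3]] i)
  independent := by
    refine affineIndependent_of_sum_smul fun (w : Fin 3 → ℝ) hw h => ?_
    have h' : ∑ i : Fin 3, w i • (F.chart.symm (![![0, 0, 0], ![2 / 3, -1 / 3, -1 / 3],
        ![1 / 3, 1 / 3, -2 / 3]] i) - F.origin) = 0 := by
      simp only [smul_sub, Finset.sum_sub_distrib, ← Finset.sum_smul]
      rw [h, hw]
      simp
    replace hw : w 0 + w 1 + w 2 = 0 := by rw [← Fin.sum_univ_three]; exact hw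
    have h2 := congrArg F.basis.equivFun h'
    rw [map_sum, map_zero] at h2
    simp only [map_smul, ← chart_apply, AffineEquiv.apply_symm_apply] at h2
    rw [Fin.sum_univ_three] at h2
    have e0 := congrFun h2 0
    have e1 := congrFun h2 1
    simp at e0 e1
    have hw1 : w 1 = 0 := by linarith
    have hw2 : w 2 = 0 := by linarith
    have hw0 : w 0 = 0 := by linarith
    intro i; fin_cases i <;> assumption

theorem chart_base (i : Fin 3) : F.chart (F.base.points i) =
    ![![0, 0, 0], ![2 / 3, -1 / 3, -1 / 3], ![1 / 3, 1 / 3, -2 / 3]] i := by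
  simp [base]

theorem equilateral_base : F.base.Equilateral := by
  have h : ∀ i j : Fin 3, i ≠ j →
      dist (F.base.points i) (F.base.points j) ^ 2 = (F.sq - F.prod) * (2 / 3) := by
    intro i j hij
    rw [F.dist_sq_eq, F.chart_base, F.chart_base]
    fin_cases i <;> fin_cases j <;> simp [Fin.sum_univ_three] at hij ⊢ <;> ring
  refine ⟨√((F.sq - F.prod) * (2 / 3)), fun i j hij => ?_⟩
  rw [← h i j hij, Real.sqrt_sq dist_nonneg]

theorem mem_prismAxis_base {v : E3} : v ∈ prismAxis F.base ↔
    F.basis.equivFun v 0 = F.basis.equivFun v 1 ∧ F.basis.equivFun v 1 = F.basis.equivFun v 2 := by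
  have hpos := sub_pos.2 F.prod_lt_sq
  have hc : ∀ i : Fin 3, F.basis.equivFun (F.base.points i - F.base.points 0) =
      ![![0, 0, 0], ![2 / 3, -1 / 3, -1 / 3], ![1 / 3, 1 / 3, -2 / 3]] i := by
    intro i
    rw [← F.chart_sub, F.chart_base, F.chart_base]
    ext k; fin_cases k <;> simp
  constructor
  · intro h
    have h' : ∀ i, inner ℝ (F.base.points i - F.base.points 0) v = 0 := fun i =>
      (Submodule.mem_orthogonal _ _).1 h _
        (vsub_mem_vectorSpan ℝ (mem_range_self i) (mem_range_self 0))
    have h1 := h' 1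
    have h2 := h' 2
    rw [F.inner_eq, hc] at h1 h2
    simp only [Fin.sum_univ_three] at h1 h2
    simp at h1 h2
    ring_nf at h1 h2
    simp only [Module.Basis.equivFun_apply]
    constructor <;> apply mul_left_cancel₀ hpos.ne' <;> linarith
  · rintro ⟨h0, h1⟩
    rw [prismAxis, Submodule.mem_orthogonal,
      vectorSpan_range_eq_span_range_vsub_right ℝ F.base.points 0]
    intro u hu
    induction hu using Submodule.span_induction with
    | mem u hu =>
      obtain ⟨i, rfl⟩ := hu
      change inner ℝ (F.base.points i - F.base.points 0) v = 0
      rw [F.inner_eq, hc]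
      simp only [Fin.sum_univ_three, h0, h1]
      fin_cases i <;> simp <;> ring
    | zero => simp
    | add u w _ _ hu hw => rw [inner_add_left, hu, hw, add_zero]
    | smul a u _ hu => rw [real_inner_smul_left, hu, mul_zero]

theorem prism_base : prism F.base = F.column := by
  ext x
  constructor
  · rintro ⟨y, hy, v, hv, rfl⟩
    have hy' : y ∈ F.column := by
      refine convexHull_min ?_ F.convex_column hy
      rintro _ ⟨i, rfl⟩
      refine ⟨?_, ?_, ?_⟩ <;> rw [F.chart_base] <;> fin_cases i <;> simp <;> norm_num
    obtain ⟨h0, h1⟩ := F.mem_prismAxis_base.1 hv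
    have hc : ∀ i, F.chart (y + v) i = F.chart y i + F.basis.equivFun v i := fun i => by
      rw [chart_apply, chart_apply, add_sub_right_comm, map_add, Pi.add_apply]
    obtain ⟨a1, a2, a3⟩ := hy'
    refine ⟨?_, ?_, ?_⟩ <;> simp only [hc] <;> linarith
  · rintro ⟨a1, a2, a3⟩
    -- The slacks of the three column inequalities are the barycentric coordinates of the projection
    -- to the base.
    set w : Fin 3 → ℝ := ![1 - (F.chart x 0 - F.chart x 2), F.chart x 0 - F.chart x 1,
      F.chart x 1 - F.chart x 2] with hw
    have hw1 : ∑ i, w i = 1 := by simp [hw, Fin.sum_univ_three]; ring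
    refine ⟨∑ i, w i • F.base.points i, ?_, x - ∑ i, w i • F.base.points i, ?_, by abel⟩
    · refine (convex_convexHull ℝ _).sum_mem (fun i _ => ?_) hw1
        fun i _ => subset_convexHull ℝ _ (mem_range_self i)
      fin_cases i <;> simp [hw] <;> linarith
    · rw [F.mem_prismAxis_base, ← F.chart_sub]
      have hs : ∀ k, F.chart (∑ i, w i • F.base.points i) k = ∑ i, w i * F.chart (F.base.points i) k :=
        F.chart_sum hw1 F.base.points
      simp only [Pi.sub_apply, hs]
      simp only [Fin.sum_univ_three, F.chart_base]
      simp [hw]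
      constructor <;> ring

/-- A coordinate test for being the mirror: the displacement is orthogonal to the axis (`h1`) and to
the base edge (`h2`), and the midpoint lies on the wall (`h3`). -/
theorem prismMirror_base_eq {i : Fin 3} {g : E3 ≃ᵃⁱ[ℝ] E3}
    (h1 : ∀ x, ∑ j, (F.chart (g x) j - F.chart x j) = 0)
    (h2 : ∀ x, ∑ j, (F.chart (F.base.points (i + 2)) j - F.chart (F.base.points (i + 1)) j) *
      (F.chart (g x) j - F.chart x j) = 0)
    (h3 : ∀ x, ∃ a b : ℝ, ∀ j, (F.chart x j + F.chart (g x) j) / 2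
      - F.chart (F.base.points (i + 1)) j =
      a * (F.chart (F.base.points (i + 2)) j - F.chart (F.base.points (i + 1)) j) + b) :
    prismMirror F.base i = g := by
  ext1 x
  refine reflection_eq_of_midpoint_mem ?_ ?_
  · obtain ⟨a, b, hab⟩ := h3 x
    rw [prismWall, AffineSubspace.mem_mk', vsub_eq_sub]
    set d := F.base.points (i + 2) - F.base.points (i + 1) with hd
    refine Submodule.mem_sup.2 ⟨a • d, Submodule.smul_mem _ _ (Submodule.mem_span_singleton_self _),
      midpoint ℝ x (g x) - F.base.points (i + 1) - a • d, ?_, by abel⟩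
    have hc : ∀ j, F.basis.equivFun (midpoint ℝ x (g x) - F.base.points (i + 1) - a • d) j = b := by
      intro j
      have hmid : midpoint ℝ x (g x) = (1 / 2 : ℝ) • x + (1 / 2 : ℝ) • g x := by
        rw [midpoint_eq_smul_add, invOf_eq_inv]; module
      rw [map_sub, map_smul, hd, ← F.chart_sub, ← F.chart_sub, hmid]
      simp only [Pi.sub_apply, Pi.smul_apply, smul_eq_mul,
        F.chart_combo (show (1 / 2 : ℝ) + 1 / 2 = 1 by norm_num)]
      linarith [hab j]
    rw [F.mem_prismAxis_base, hc, hc, hc]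
    exact ⟨rfl, rfl⟩
  · rw [prismWall, AffineSubspace.direction_mk', Submodule.mem_orthogonal]
    intro u hu
    obtain ⟨u1, hu1, u2, hu2, rfl⟩ := Submodule.mem_sup.1 hu
    obtain ⟨a, rfl⟩ := Submodule.mem_span_singleton.1 hu1
    obtain ⟨e0, e1⟩ := F.mem_prismAxis_base.1 hu2
    have s1 := h1 x
    have s2 := h2 x
    rw [inner_add_left, real_inner_smul_left, F.inner_eq, F.inner_eq, ← F.chart_sub,
      ← F.chart_sub]
    simp only [Pi.sub_apply, s1, s2, mul_zero, add_zero, zero_add]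
    rw [Fin.sum_univ_three] at s1
    rw [Fin.sum_univ_three, e0, e1, ← mul_add, ← mul_add, s1]
    simp

theorem prismMirror_base_mem_group (i : Fin 3) : prismMirror F.base i ∈ F.group := by
  have main : ∀ (n : Fin 3 → ℤ) (σ : Equiv.Perm (Fin 3)),
      (∀ x : Fin 3 → ℝ, ∑ j, (n j + x (σ j) - x j) = 0) →
      (∀ x : Fin 3 → ℝ, ∑ j, (F.chart (F.base.points (i + 2)) j
        - F.chart (F.base.points (i + 1)) j) * (n j + x (σ j) - x j) = 0) →
      (∀ x : Fin 3 → ℝ, ∃ a b : ℝ, ∀ j, (x j + (n j + x (σ j))) / 2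
        - F.chart (F.base.points (i + 1)) j =
        a * (F.chart (F.base.points (i + 2)) j - F.chart (F.base.points (i + 1)) j) + b) →
      prismMirror F.base i ∈ F.group := by
    intro n σ h1 h2 h3
    obtain ⟨g, hg, hgx⟩ := F.exists_mem_group n σ
    rw [F.prismMirror_base_eq (g := g)]
    · exact hg
    · intro x; simp only [hgx]; exact h1 _
    · intro x; simp only [hgx]; exact h2 _
    · intro x; simp only [hgx]; exact h3 _
  simp only [F.chart_base] at main
  fin_cases i
  -- The wall opposite base vertex 0 is `x₀ = x₂ + 1`; the other two are `x₀ = x₁` and `x₁ = x₂`.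
  · refine main ![1, 0, -1] (Equiv.swap 0 2) ?_ ?_ ?_
    · intro x; simp [Fin.sum_univ_three, Equiv.swap_apply_def]; ring
    · intro x; simp [Fin.sum_univ_three, Equiv.swap_apply_def]; ring
    · intro x
      refine ⟨x 1 - (x 0 + x 2) / 2 + 1 / 2, (x 0 + x 1 + x 2) / 3, ?_⟩
      intro j; fin_cases j <;> simp [Equiv.swap_apply_def] <;> ring
  · refine main 0 (Equiv.swap 0 1) ?_ ?_ ?_
    · intro x; simp [Fin.sum_univ_three, Equiv.swap_apply_def]; ring
    · intro x; simp [Fin.sum_univ_three, Equiv.swap_apply_def]; ring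
    · intro x
      refine ⟨x 2 - (x 0 + x 1) / 2 + 1, (x 0 + x 1 + x 2) / 3, ?_⟩
      intro j; fin_cases j <;> simp [Equiv.swap_apply_def] <;> ring
  · refine main 0 (Equiv.swap 1 2) ?_ ?_ ?_
    · intro x; simp [Fin.sum_univ_three, Equiv.swap_apply_def]; ring
    · intro x; simp [Fin.sum_univ_three, Equiv.swap_apply_def]; ring
    · intro x
      refine ⟨x 0 - (x 1 + x 2) / 2, (x 0 + x 1 + x 2) / 3, ?_⟩
      intro j; fin_cases j <;> simp [Equiv.swap_apply_def] <;> ring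

/-- The image of a frame under an isometry. -/
noncomputable def map (g : E3 ≃ᵃⁱ[ℝ] E3) : SymmetricFrame where
  origin := g F.origin
  basis := F.basis.map g.linearIsometryEquiv.toLinearEquiv
  sq := F.sq
  prod := F.prod
  inner_basis i j := by simp [F.inner_basis]

theorem chart_map_apply (g : E3 ≃ᵃⁱ[ℝ] E3) (x : E3) : (F.map g).chart (g x) = F.chart x := by
  have h : g x - g F.origin = g.linearIsometryEquiv (x - F.origin) := (g.map_vsub _ _).symm
  rw [chart_apply, chart_apply]
  change (F.basis.map g.linearIsometryEquiv.toLinearEquiv).equivFun (g x - g F.origin) = _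
  rw [h]
  ext i
  simp

theorem column_map (g : E3 ≃ᵃⁱ[ℝ] E3) : (F.map g).column = g '' F.column := by
  ext x
  obtain ⟨x, rfl⟩ := g.surjective x
  rw [g.injective.mem_set_image, column, column]
  simp only [mem_ofPred_eq, chart_map_apply]

/-- The group of the moved frame is a conjugate by a group element. Thus the mirrors of every prism,
not only of `column`, lie in `F.group`. -/
theorem group_map_le {g : E3 ≃ᵃⁱ[ℝ] E3} (hg : g ∈ F.group) : (F.map g).group ≤ F.group := by
  rintro h ⟨n, σ, hσ⟩
  have : g⁻¹ * h * g ∈ F.group := by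
    refine ⟨n, σ, fun x i => ?_⟩
    have e : g ((g⁻¹ * h * g) x) = h (g x) :=
      DFunLike.congr_fun (by group : g * (g⁻¹ * h * g) = h * g) x
    rw [← chart_map_apply F g, e, hσ, chart_map_apply]
  have h2 := F.group.mul_mem (F.group.mul_mem hg this) (F.group.inv_mem hg)
  rwa [show g * (g⁻¹ * h * g) * g⁻¹ = h by group] at h2

end SymmetricFrame

/-! ### Composition of direct isometries -/

theorem IsDirectIsometry.mul {g h : E3 ≃ᵃⁱ[ℝ] E3} (hg : IsDirectIsometry g)
    (hh : IsDirectIsometry h) : IsDirectIsometry (g * h) := by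
  have : ((g * h).linearIsometryEquiv.toLinearEquiv : E3 →ₗ[ℝ] E3) =
      (g.linearIsometryEquiv.toLinearEquiv : E3 →ₗ[ℝ] E3) *
      (h.linearIsometryEquiv.toLinearEquiv : E3 →ₗ[ℝ] E3) := rfl
  rw [IsDirectIsometry, this, map_mul]
  exact mul_pos hg hh

theorem IsDirectIsometry.inv {g : E3 ≃ᵃⁱ[ℝ] E3} (hg : IsDirectIsometry g) :
    IsDirectIsometry g⁻¹ := by
  have : (g.linearIsometryEquiv.toLinearEquiv : E3 →ₗ[ℝ] E3) *
      (g⁻¹.linearIsometryEquiv.toLinearEquiv : E3 →ₗ[ℝ] E3) = 1 := by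
    apply LinearMap.ext
    intro v
    exact g.linearIsometryEquiv.apply_symm_apply v
  have h2 := congrArg LinearMap.det this
  rw [map_mul, map_one] at h2
  have h3 : (0 : ℝ) < LinearMap.det (g.linearIsometryEquiv.toLinearEquiv : E3 →ₗ[ℝ] E3) := hg
  exact pos_of_mul_pos_right (h2 ▸ one_pos) h3.le

theorem IsDirectIsometry.conj {f : E3 ≃ᵃⁱ[ℝ] E3} (hf : IsDirectIsometry f)
    (g : E3 ≃ᵃⁱ[ℝ] E3) : IsDirectIsometry (g * f * g⁻¹) := by
  have := LinearMap.det_conj (f.linearIsometryEquiv.toLinearEquiv : E3 →ₗ[ℝ] E3)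
    g.linearIsometryEquiv.toLinearEquiv
  rw [IsDirectIsometry] at hf ⊢
  rw [← this] at hf
  exact hf

theorem directlyCongruent_image_image {S : Set E3} {g h : E3 ≃ᵃⁱ[ℝ] E3}
    (hg : IsDirectIsometry g) (hh : IsDirectIsometry h) : DirectlyCongruent (g '' S) (h '' S) := by
  refine ⟨h * g⁻¹, hh.mul hg.inv, ?_⟩
  rw [AffineIsometryEquiv.coe_mul, image_comp, ← image_comp _ g, ← AffineIsometryEquiv.coe_mul]
  simp

theorem image_mul_eq (g h : E3 ≃ᵃⁱ[ℝ] E3) (S : Set E3) : (g * h) '' S = g '' (h '' S) := by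
  rw [AffineIsometryEquiv.coe_mul, image_comp]

theorem convex_image_isometry {S : Set E3} (hS : Convex ℝ S) (g : E3 ≃ᵃⁱ[ℝ] E3) :
    Convex ℝ (g '' S) :=
  hS.affine_image (g.toAffineEquiv : E3 →ᵃ[ℝ] E3)

theorem MeetsNicely.of_inv_mul {K L : Set E3} {g h : E3 ≃ᵃⁱ[ℝ] E3}
    (H : MeetsNicely ((h⁻¹ * g) '' K) L) : MeetsNicely (g '' K) (h '' L) := by
  have := H.image h
  rwa [← image_mul_eq, mul_inv_cancel_left] at this

/-! ### The tiling generated by the group from pieces of the Kuhn simplex -/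

namespace SymmetricFrame

variable (F : SymmetricFrame)

/-- The images of the sets `K i` under the group of a frame. -/
def tiles {ι : Type*} (K : ι → Set E3) : Set (Set E3) :=
  {L | ∃ g ∈ F.group, ∃ i, L = g '' K i}

variable {F} {ι : Type*} {K : ι → Set E3}

theorem image_mem_tiles {g : E3 ≃ᵃⁱ[ℝ] E3} (hg : g ∈ F.group) {L : Set E3} (hL : L ∈ F.tiles K) :
    g '' L ∈ F.tiles K := by
  obtain ⟨h, hh, i, rfl⟩ := hL
  exact ⟨g * h, F.group.mul_mem hg hh, i, (image_mul_eq _ _ _).symm⟩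

theorem tilesIn_image {g : E3 ≃ᵃⁱ[ℝ] E3} (hg : g ∈ F.group) (P : Set E3) :
    tilesIn (F.tiles K) (g '' P) = (fun L => g '' L) '' tilesIn (F.tiles K) P := by
  ext L
  constructor
  · rintro ⟨hL, hLP⟩
    refine ⟨⇑(g⁻¹) '' L, ⟨image_mem_tiles (F.group.inv_mem hg) hL, ?_⟩, ?_⟩
    · have := image_mono (f := ⇑(g⁻¹)) hLP
      rwa [← image_mul_eq, inv_mul_cancel, AffineIsometryEquiv.coe_one, image_id] at this
    · change g '' (⇑(g⁻¹) '' L) = L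
      rw [← image_mul_eq, mul_inv_cancel, AffineIsometryEquiv.coe_one, image_id]
  · rintro ⟨M, ⟨hM, hMP⟩, rfl⟩
    exact ⟨image_mem_tiles hg hM, image_mono hMP⟩

theorem isFaceToFaceTiling_tiles {T : Tetrahedron} (hK : ⋃ i, K i = F.tetra)
    (hT : ∀ i, ∃ h, IsDirectIsometry h ∧ h '' T.body = K i)
    (hmeet : ∀ g ∈ F.group, ∀ i j, MeetsNicely (g '' K i) (K j)) :
    IsFaceToFaceTiling T (F.tiles K) := by
  have hmeet' : ∀ L ∈ F.tiles K, ∀ M ∈ F.tiles K, MeetsNicely L M := by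
    rintro _ ⟨g, hg, i, rfl⟩ _ ⟨h, hh, j, rfl⟩
    exact (hmeet _ (F.group.mul_mem (F.group.inv_mem hh) hg) i j).of_inv_mul
  have hconv : ∀ L ∈ F.tiles K, Convex ℝ L := by
    rintro _ ⟨g, hg, i, rfl⟩
    obtain ⟨h, -, hi⟩ := hT i
    rw [← hi]
    exact convex_image_isometry (convex_image_isometry (convex_convexHull ℝ _) _) _
  refine ⟨?_, ?_, ?_, ?_⟩
  · rintro _ ⟨g, hg, i, rfl⟩
    obtain ⟨h, -, hi⟩ := hT i
    exact ⟨g * h, by rw [image_mul_eq, hi]⟩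
  · refine eq_univ_of_forall fun x => ?_
    obtain ⟨g, hg, y, hy, rfl⟩ := F.exists_mem_image_tetra x
    rw [← hK] at hy
    obtain ⟨i, hi⟩ := mem_iUnion.1 hy
    exact ⟨g '' K i, ⟨g, hg, i, rfl⟩, mem_image_of_mem g hi⟩
  · intro L hL M hM hne
    by_contra hd
    exact hne ((hmeet' L hL M hM).subset_of_overlap hd |>.antisymm
      ((hmeet' M hM L hL).subset_of_overlap fun h => hd h.symm))
  · intro L hL M hM
    refine ⟨⟨(hconv L hL).inter (hconv M hM), (hmeet' L hL M hM).isExtreme⟩,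
      ⟨(hconv L hL).inter (hconv M hM), ?_⟩⟩
    rw [inter_comm]
    exact (hmeet' M hM L hL).isExtreme

theorem isAlternatingPrismDissection_tiles {T : Tetrahedron} (hK : ⋃ i, K i = F.tetra)
    (hT : ∀ i, ∃ h, IsDirectIsometry h ∧ h '' T.body = K i)
    (h1 : ∀ i, F.vertex 1 ∈ K i) (h2 : ∀ i, F.vertex 2 ∈ K i)
    (h03 : ∀ i, F.vertex 0 ∈ K i ∨ F.vertex 3 ∈ K i) :
    IsAlternatingPrismDissection (F.tiles K) := by
  have hKt : ∀ i, K i ⊆ F.tetra := fun i => hK ▸ subset_iUnion K i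
  refine ⟨{P | ∃ g ∈ F.group, P = g '' F.column}, ?_, ?_, ?_, ?_⟩
  · refine eq_univ_of_forall fun x => ?_
    obtain ⟨g, hg, hx⟩ := F.exists_mem_image_tetra x
    exact ⟨g '' F.column, ⟨g, hg, rfl⟩, image_mono F.tetra_subset_column hx⟩
  · rintro _ ⟨g, hg, rfl⟩ _ ⟨h, hh, rfl⟩ hne
    by_contra hd
    have H : ∀ {g h : E3 ≃ᵃⁱ[ℝ] E3}, g ∈ F.group → h ∈ F.group →
        MeetsNicely (g '' F.column) (h '' F.column) := fun hg hh =>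
      (F.meetsNicely_column (F.group.mul_mem (F.group.inv_mem hh) hg)).of_inv_mul
    exact hne (((H hg hh).subset_of_overlap hd).antisymm
      ((H hh hg).subset_of_overlap fun h => hd h.symm))
  · rintro _ ⟨g, hg, i, rfl⟩
    exact ⟨g '' F.column, ⟨g, hg, rfl⟩, image_mono ((hKt i).trans F.tetra_subset_column)⟩
  · rintro _ ⟨g, hg, rfl⟩
    refine ⟨?_, ?_, (F.map g).base, (F.map g).equilateral_base, ?_, fun i => ?_⟩
    · refine Subset.antisymm (sUnion_subset fun L hL => hL.2) ?_
      rintro _ ⟨x, hx, rfl⟩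
      obtain ⟨h, hh, hsub, y, hy, rfl⟩ := F.exists_image_tetra_subset_column hx
      rw [← hK] at hy
      obtain ⟨i, hi⟩ := mem_iUnion.1 hy
      refine ⟨(g * h) '' K i, ⟨⟨_, F.group.mul_mem hg hh, i, rfl⟩, ?_⟩, _, hi, rfl⟩
      rw [image_mul_eq]
      exact image_mono ((image_mono (hKt i)).trans hsub)
    · rw [tilesIn_image hg]
      have key : ∀ L ∈ tilesIn (F.tiles K) F.column,
          ∃ h, IsDirectIsometry h ∧ L = h '' T.body := by
        rintro _ ⟨⟨h, hh, i, rfl⟩, hL⟩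
        obtain ⟨k, hk, hki⟩ := hT i
        refine ⟨h * k, (F.isDirectIsometry_of_image_subset_column hh (h1 i) (h2 i) (h03 i) hL).mul
          hk, ?_⟩
        rw [image_mul_eq, hki]
      rintro _ ⟨L, hL, rfl⟩ _ ⟨M, hM, rfl⟩
      obtain ⟨h, hh, rfl⟩ := key L hL
      obtain ⟨k, hk, rfl⟩ := key M hM
      obtain ⟨f, hf, hfe⟩ := directlyCongruent_image_image (S := T.body) hh hk
      refine ⟨g * f * g⁻¹, hf.conj g, ?_⟩
      change (g * f * g⁻¹) '' (g '' (h '' T.body)) = g '' (k '' T.body)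
      rw [← image_mul_eq, inv_mul_cancel_right, image_mul_eq, hfe]
    · rw [(F.map g).prism_base, F.column_map]
    · have hm : prismMirror (F.map g).base i ∈ F.group :=
        F.group_map_le hg ((F.map g).prismMirror_base_mem_group i)
      exact ⟨⟨_, F.group.mul_mem hm hg, (image_mul_eq _ _ _).symm⟩, tilesIn_image hm _⟩

end SymmetricFrame

/-! ### Recognising a symmetric frame from edge lengths -/

theorem sum_smul_eq_zero_of_affineIndependent {ι : Type*} [Fintype ι] {p : ι → E3}
    (hp : AffineIndependent ℝ p) {w : ι → ℝ} (hw : ∑ i, w i = 0) (h : ∑ i, w i • p i = 0) (i : ι) :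
    w i = 0 := by
  rw [affineIndependent_iff_of_fintype] at hp
  refine hp w hw ?_ i
  rwa [Finset.weightedVSub_eq_linear_combination _ hw]

theorem linearIndependent_path {p : Fin 4 → E3} (hp : AffineIndependent ℝ p) :
    LinearIndependent ℝ ![p 1 - p 0, p 2 - p 1, p 3 - p 2] := by
  rw [Fintype.linearIndependent_iff]
  intro c hc
  -- Summation by parts turns coefficients of successive differences into weights on the points.
  have h := sum_smul_eq_zero_of_affineIndependent hp
    (w := ![-c 0, c 0 - c 1, c 1 - c 2, c 2]) (by simp [Fin.sum_univ_four]; ring) (by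
      rw [Fin.sum_univ_three] at hc
      rw [Fin.sum_univ_four, ← hc]
      simp
      module)
  have h0 := h 0
  have h2 := h 2
  have h3 := h 3
  simp at h0 h2 h3
  intro i; fin_cases i <;> simp <;> linarith

/-- The two sides of length `c` make the inner products of consecutive path vectors equal. The side
`a` determines the remaining one, and `hrel` is exactly the condition that it agrees. -/
theorem exists_symmetricFrame {p : Fin 4 → E3} (hp : AffineIndependent ℝ p) {a b c : ℝ}
    (hrel : a ^ 2 / 3 + b ^ 2 = c ^ 2) (h01 : dist (p 0) (p 1) ^ 2 = b ^ 2)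
    (h12 : dist (p 1) (p 2) ^ 2 = b ^ 2) (h23 : dist (p 2) (p 3) ^ 2 = b ^ 2)
    (h02 : dist (p 0) (p 2) ^ 2 = c ^ 2) (h13 : dist (p 1) (p 3) ^ 2 = c ^ 2)
    (h03 : dist (p 0) (p 3) ^ 2 = a ^ 2) :
    ∃ F : SymmetricFrame, ∀ k, F.vertex k = p k := by
  obtain ⟨x, hx⟩ : ∃ x, x = p 1 - p 0 := ⟨_, rfl⟩
  obtain ⟨y, hy⟩ : ∃ y, y = p 2 - p 1 := ⟨_, rfl⟩
  obtain ⟨z, hz⟩ : ∃ z, z = p 3 - p 2 := ⟨_, rfl⟩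
  have hli := linearIndependent_path hp
  rw [← hx, ← hy, ← hz] at hli
  rw [dist_comm, dist_eq_norm] at h01 h12 h23 h02 h13 h03
  rw [show p 1 - p 0 = x by rw [hx], ← real_inner_self_eq_norm_sq] at h01
  rw [show p 2 - p 1 = y by rw [hy], ← real_inner_self_eq_norm_sq] at h12
  rw [show p 3 - p 2 = z by rw [hz], ← real_inner_self_eq_norm_sq] at h23
  rw [show p 2 - p 0 = x + y by rw [hx, hy]; abel, ← real_inner_self_eq_norm_sq] at h02
  rw [show p 3 - p 1 = y + z by rw [hy, hz]; abel, ← real_inner_self_eq_norm_sq] at h13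
  rw [show p 3 - p 0 = x + y + z by rw [hx, hy, hz]; abel, ← real_inner_self_eq_norm_sq] at h03
  simp only [inner_add_left, inner_add_right] at h02 h13 h03
  have n1 := real_inner_self_eq_norm_sq x
  have n2 := real_inner_self_eq_norm_sq y
  have n3 := real_inner_self_eq_norm_sq z
  have c1 := real_inner_comm x y
  have c2 := real_inner_comm x z
  have c3 := real_inner_comm y z
  let B := basisOfLinearIndependentOfCardEqFinrank hli (by simp)
  have hB : ∀ i, B i = ![x, y, z] i := fun i => by simp [B]
  let F : SymmetricFrame :=
    { origin := p 0
      basis := B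
      sq := b ^ 2
      prod := (c ^ 2 - 2 * b ^ 2) / 2
      inner_basis := by
        intro i j
        rw [hB, hB]
        fin_cases i <;> fin_cases j <;> simp <;> linarith }
  have hF : ∀ k, F.chart (p k) = ![![0, 0, 0], ![1, 0, 0], ![1, 1, 0], ![1, 1, 1]] k := by
    intro k
    rw [SymmetricFrame.chart_apply]
    change B.equivFun (p k - p 0) = _
    rw [← LinearEquiv.eq_symm_apply, Module.Basis.equivFun_symm_apply, Fin.sum_univ_three, hB, hB,
      hB]
    fin_cases k <;> simp [hx, hy, hz]
  refine ⟨F, fun k => F.chart.injective ?_⟩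
  rw [F.chart_vertex, hF]

/-! ### The simplex and its halves as convex hulls -/

namespace SymmetricFrame

variable (F : SymmetricFrame)

theorem convex_tetra : Convex ℝ F.tetra := by
  rintro x ⟨a1, a2, a3, a4⟩ y ⟨b1, b2, b3, b4⟩ s t hs ht hst
  refine ⟨?_, ?_, ?_, ?_⟩ <;> simp only [F.chart_combo hst] <;> nlinarith

theorem convex_half (ε : ℝ) : Convex ℝ (F.half ε) := by
  rintro x hx y hy s t hs ht hst
  obtain ⟨hx, hx'⟩ := F.mem_half.1 hx
  obtain ⟨hy, hy'⟩ := F.mem_half.1 hy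
  refine F.mem_half.2 ⟨F.convex_tetra hx hy hs ht hst, ?_⟩
  simp only [F.chart_combo hst]
  have := mul_nonneg hs hx'
  have := mul_nonneg ht hy'
  obtain rfl : t = 1 - s := by linarith
  linarith

theorem mem_convexHull_of_chart {q : Fin 4 → E3} {x : E3} {w : Fin 4 → ℝ} (hw : ∀ j, 0 ≤ w j)
    (hw1 : ∑ j, w j = 1) (hx : ∀ i, F.chart x i = ∑ j, w j * F.chart (q j) i) :
    x ∈ convexHull ℝ (range q) := by
  have : x = ∑ j, w j • q j := by
    apply F.chart.injective
    ext i
    rw [hx, F.chart_sum hw1]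
  rw [this]
  exact (convex_convexHull ℝ _).sum_mem (fun i _ => hw i) hw1
    fun i _ => subset_convexHull ℝ _ (mem_range_self i)

theorem vertex_mem_tetra (k : Fin 4) : F.vertex k ∈ F.tetra := by
  refine ⟨?_, ?_, ?_, ?_⟩ <;> rw [F.chart_vertex] <;> fin_cases k <;> simp

theorem convexHull_vertex : convexHull ℝ (range F.vertex) = F.tetra := by
  refine (convexHull_min ?_ F.convex_tetra).antisymm ?_
  · rintro _ ⟨k, rfl⟩
    exact F.vertex_mem_tetra k
  · rintro x ⟨a1, a2, a3, a4⟩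
    refine F.mem_convexHull_of_chart (w := ![1 - F.chart x 0, F.chart x 0 - F.chart x 1,
      F.chart x 1 - F.chart x 2, F.chart x 2]) ?_ ?_ ?_
    · intro j; fin_cases j <;> simp <;> linarith
    · simp [Fin.sum_univ_four]
    · intro i
      simp only [Fin.sum_univ_four, F.chart_vertex]
      fin_cases i <;> simp

theorem convexHull_half {q : Fin 4 → E3} (h0 : q 0 = F.vertex 0) (h1 : q 1 = F.vertex 1)
    (h2 : q 2 = F.vertex 2) (h3 : ∀ i, F.chart (q 3) i = 1 / 2) :
    convexHull ℝ (range q) = F.half 1 := by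
  refine (convexHull_min ?_ (F.convex_half 1)).antisymm ?_
  · rintro _ ⟨k, rfl⟩
    refine F.mem_half.2 ?_
    fin_cases k
    · exact ⟨h0 ▸ F.vertex_mem_tetra 0, by simp [h0, F.chart_vertex]⟩
    · exact ⟨h1 ▸ F.vertex_mem_tetra 1, by simp [h1, F.chart_vertex]⟩
    · exact ⟨h2 ▸ F.vertex_mem_tetra 2, by simp [h2, F.chart_vertex]⟩
    · refine ⟨⟨?_, ?_, ?_, ?_⟩, ?_⟩ <;> simp [h3] <;> norm_num
  · rintro x hx
    obtain ⟨⟨a1, a2, a3, a4⟩, a5⟩ := F.mem_half.1 hx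
    -- Obtained from the barycentric coordinates in `tetra` by replacing vertex 3 with twice the
    -- midpoint `q 3` minus vertex 0.
    refine F.mem_convexHull_of_chart (w := ![1 - F.chart x 0 - F.chart x 2,
      F.chart x 0 - F.chart x 1, F.chart x 1 - F.chart x 2, 2 * F.chart x 2]) ?_ ?_ ?_
    · intro j; fin_cases j <;> simp <;> linarith
    · simp [Fin.sum_univ_four]; ring
    · intro i
      simp only [Fin.sum_univ_four, h0, h1, h2, h3, F.chart_vertex]
      fin_cases i <;> simp <;> ring

/-- The map `x ↦ (1 - x₂, 1 - x₁, 1 - x₀)`. Both the negation in dimension three and the swap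
reverse orientation, so it is direct. -/
theorem exists_halfTurn : ∃ g : E3 ≃ᵃⁱ[ℝ] E3, IsDirectIsometry g ∧
    (∀ k, g (F.vertex k) = F.vertex k.rev) ∧ g '' F.half 1 = F.half (-1) := by
  obtain ⟨g, hg⟩ := F.exists_isometry (-1) (by norm_num) (fun _ => 1) (Equiv.swap 0 2)
  have g0 : ∀ x, F.chart (g x) 0 = 1 - F.chart x 2 := fun x => by simp [hg]; ring
  have g1 : ∀ x, F.chart (g x) 1 = 1 - F.chart x 1 := fun x => by
    simp [hg, Equiv.swap_apply_def]; ring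
  have g2 : ∀ x, F.chart (g x) 2 = 1 - F.chart x 0 := fun x => by simp [hg]; ring
  have hgg : ∀ x, g (g x) = x := fun x => by
    apply F.chart.injective
    ext i; fin_cases i <;> simp [g0, g1, g2]
  refine ⟨g, ?_, ?_, ?_⟩
  · rw [IsDirectIsometry, F.det_eq hg, Equiv.Perm.sign_swap (by decide)]
    norm_num
  · intro k
    apply F.chart.injective
    ext i
    fin_cases k <;> fin_cases i <;> simp [g0, g1, g2, F.chart_vertex, Fin.rev]
  · ext x
    simp only [mem_image, mem_half, tetra, mem_ofPred_eq]
    constructor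
    · rintro ⟨y, ⟨⟨a1, a2, a3, a4⟩, a5⟩, rfl⟩
      rw [g0, g1, g2]
      exact ⟨⟨by linarith, by linarith, by linarith, by linarith⟩, by linarith⟩
    · rintro ⟨⟨a1, a2, a3, a4⟩, a5⟩
      refine ⟨g x, ?_, hgg x⟩
      rw [g0, g1, g2]
      exact ⟨⟨by linarith, by linarith, by linarith, by linarith⟩, by linarith⟩

end SymmetricFrame

theorem isDirectIsometry_one : IsDirectIsometry 1 := by
  have : ((1 : E3 ≃ᵃⁱ[ℝ] E3).linearIsometryEquiv.toLinearEquiv : E3 →ₗ[ℝ] E3) = 1 := rfl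
  rw [IsDirectIsometry, this, map_one]
  exact one_pos

namespace Tetrahedron

theorem IsGoldbergFirst.exists_frame {a b c : ℝ} {T : Tetrahedron} (h : T.IsGoldbergFirst a b c) :
    ∃ F : SymmetricFrame, ∀ k, F.vertex k = T.points k :=
  exists_symmetricFrame T.independent h.rel (congrArg (· ^ 2) h.len12) (congrArg (· ^ 2) h.len23)
    (congrArg (· ^ 2) h.len34) (congrArg (· ^ 2) h.len13) (congrArg (· ^ 2) h.len24)
    (congrArg (· ^ 2) h.len14)

theorem IsGoldbergFirst.exists_tiling {a b c : ℝ} {T : Tetrahedron} (h : T.IsGoldbergFirst a b c) :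
    ∃ 𝒯 : Set (Set E3), IsFaceToFaceTiling T 𝒯 ∧ IsAlternatingPrismDissection 𝒯 := by
  obtain ⟨F, hF⟩ := h.exists_frame
  have hbody : T.body = F.tetra := by
    rw [← F.convexHull_vertex, body, show F.vertex = T.points from funext hF]
  have hK : ⋃ _ : Unit, F.tetra = F.tetra := iUnion_const _
  have hT : ∀ _ : Unit, ∃ h, IsDirectIsometry h ∧ h '' T.body = F.tetra := fun _ =>
    ⟨1, isDirectIsometry_one, by simp [hbody]⟩
  exact ⟨F.tiles fun _ : Unit => F.tetra,
    SymmetricFrame.isFaceToFaceTiling_tiles hK hT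
      fun g hg _ _ => F.meetsNicely_tetra hg Subset.rfl,
    SymmetricFrame.isAlternatingPrismDissection_tiles hK hT (fun _ => F.vertex_mem_tetra 1)
      (fun _ => F.vertex_mem_tetra 2) fun _ => Or.inl (F.vertex_mem_tetra 0)⟩

/-- Doubling the edge `V₁V₄` beyond `V₄` gives a tetrahedron with the edge lengths of the first
family. -/
theorem IsGoldbergSecond.exists_frame {a b c d : ℝ} {T : Tetrahedron}
    (h : T.IsGoldbergSecond a b c d) : ∃ F : SymmetricFrame,
      F.vertex 0 = T.points 0 ∧ F.vertex 1 = T.points 1 ∧ F.vertex 2 = T.points 2 ∧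
      F.vertex 3 = (2 : ℝ) • T.points 3 - T.points 0 := by
  set p : Fin 4 → E3 :=
    ![T.points 0, T.points 1, T.points 2, (2 : ℝ) • T.points 3 - T.points 0] with hp
  have hind : AffineIndependent ℝ p := by
    refine affineIndependent_of_sum_smul fun w hw h => ?_
    rw [Fin.sum_univ_four] at hw h
    have h' := sum_smul_eq_zero_of_affineIndependent T.independent
      (w := ![w 0 - w 3, w 1, w 2, 2 * w 3])
      (by rw [Fin.sum_univ_four]; simp; linarith)
      (by rw [Fin.sum_univ_four, ← h]; simp [hp]; module)
    have h0 := h' 0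
    have h1 := h' 1
    have h2 := h' 2
    have h3 := h' 3
    simp at h0 h1 h2 h3
    intro i; fin_cases i <;> simp <;> linarith
  -- The parallelogram law, as `T.points 3` is the midpoint of the doubled edge.
  have hmed : ∀ x : E3, dist x ((2 : ℝ) • T.points 3 - T.points 0) ^ 2 =
      2 * dist x (T.points 3) ^ 2 + 2 * dist (T.points 0) (T.points 3) ^ 2
        - dist (T.points 0) x ^ 2 := by
    intro x
    rw [dist_comm (T.points 0) x]
    simp only [dist_eq_norm]
    rw [show x - ((2 : ℝ) • T.points 3 - T.points 0)
      = (x - T.points 3) + (T.points 0 - T.points 3) by module,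
      show x - T.points 0 = (x - T.points 3) - (T.points 0 - T.points 3) by abel]
    rw [norm_add_sq_real, norm_sub_sq_real (x - T.points 3) (T.points 0 - T.points 3)]; ring
  have l01 : dist (T.points 0) (T.points 1) = b := h.len12
  have l02 : dist (T.points 0) (T.points 2) = c := h.len13
  have l03 : dist (T.points 0) (T.points 3) = a / 2 := h.len14
  have l12 : dist (T.points 1) (T.points 2) = b := h.len23
  have l13 : dist (T.points 1) (T.points 3) = d := h.len24
  have l23 : dist (T.points 2) (T.points 3) = d := h.len34
  have r1 := h.rel₁
  have r2 := h.rel₂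
  obtain ⟨F, hF⟩ := exists_symmetricFrame hind h.rel₂ (by simp [hp, l01]) (by simp [hp, l12])
    ((hmed (T.points 2)).trans (by rw [l23, l03, l02]; linarith))
    (by simp [hp, l02])
    ((hmed (T.points 1)).trans (by rw [l13, l03, l01]; linarith))
    ((hmed (T.points 0)).trans (by rw [l03, dist_self]; ring))
  exact ⟨F, hF 0, hF 1, hF 2, hF 3⟩

theorem IsGoldbergSecond.exists_tiling {a b c d : ℝ} {T : Tetrahedron}
    (h : T.IsGoldbergSecond a b c d) :
    ∃ 𝒯 : Set (Set E3), IsFaceToFaceTiling T 𝒯 ∧ IsAlternatingPrismDissection 𝒯 := by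
  obtain ⟨F, h0, h1, h2, h3⟩ := h.exists_frame
  have hmid : T.points 3 = (1 / 2 : ℝ) • F.vertex 0 + (1 / 2 : ℝ) • F.vertex 3 := by
    rw [h0, h3]; module
  have hbody : T.body = F.half 1 := by
    refine F.convexHull_half h0.symm h1.symm h2.symm fun i => ?_
    rw [hmid, F.chart_combo (by norm_num), F.chart_vertex, F.chart_vertex]
    fin_cases i <;> simp
  obtain ⟨g, hg, hgv, hgh⟩ := F.exists_halfTurn
  let K : Bool → Set E3 := fun s => F.half (cond s 1 (-1))
  have hK : ⋃ s, K s = F.tetra := by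
    refine (iUnion_subset fun s => inter_subset_left).antisymm fun x hx => ?_
    rw [mem_iUnion]
    rcases le_total 0 (1 - F.chart x 0 - F.chart x 2) with hs | hs
    · exact ⟨true, F.mem_half.2 ⟨hx, by simpa using hs⟩⟩
    · exact ⟨false, F.mem_half.2 ⟨hx, by simp; linarith⟩⟩
  have hT : ∀ s, ∃ h, IsDirectIsometry h ∧ h '' T.body = K s := by
    rintro (_ | _)
    · exact ⟨g, hg, by rw [hbody, hgh]; rfl⟩
    · exact ⟨1, isDirectIsometry_one, by simp [hbody, K]⟩
  have hs : ∀ s : Bool, (cond s 1 (-1) : ℝ) = 1 ∨ (cond s 1 (-1) : ℝ) = -1 := by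
    rintro (_ | _) <;> simp
  refine ⟨F.tiles K, SymmetricFrame.isFaceToFaceTiling_tiles hK hT
      fun f hf s t => F.meetsNicely_half hf (hs t) (hs s),
    SymmetricFrame.isAlternatingPrismDissection_tiles hK hT (fun s => ?_) (fun s => ?_)
      fun s => ?_⟩
  · exact F.mem_half.2 ⟨F.vertex_mem_tetra 1, by simp [F.chart_vertex]⟩
  · exact F.mem_half.2 ⟨F.vertex_mem_tetra 2, by simp [F.chart_vertex]⟩
  · rcases s with _ | _
    · exact Or.inr (F.mem_half.2 ⟨F.vertex_mem_tetra 3, by simp [F.chart_vertex]⟩)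
    · exact Or.inl (F.mem_half.2 ⟨F.vertex_mem_tetra 0, by simp [F.chart_vertex]⟩)

end Tetrahedron

/-! ### Barycentric coordinates and extreme points of a tetrahedron -/

namespace Tetrahedron

variable (T : Tetrahedron)

theorem affineSpan_points : affineSpan ℝ (range T.points) = ⊤ := by
  rw [T.independent.affineSpan_eq_top_iff_card_eq_finrank_add_one]
  simp

/-- The vertices of a tetrahedron as an affine basis of space. -/
def affineBasis : AffineBasis (Fin 4) ℝ E3 := ⟨T.points, T.independent, T.affineSpan_points⟩

theorem coord_points (i j : Fin 4) :
    T.affineBasis.coord i (T.points j) = if i = j then 1 else 0 :=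
  T.affineBasis.coord_apply i j

theorem coord_combo {s t : ℝ} (hst : s + t = 1) (x y : E3) (i : Fin 4) :
    T.affineBasis.coord i (s • x + t • y) =
      s * T.affineBasis.coord i x + t * T.affineBasis.coord i y := by
  simpa using Convex.combo_affine_apply (f := T.affineBasis.coord i) (x := x) (y := y) hst

theorem mem_body {x : E3} : x ∈ T.body ↔ ∀ i, 0 ≤ T.affineBasis.coord i x := by
  have : T.body = convexHull ℝ (range T.affineBasis) := rfl
  rw [this, AffineBasis.convexHull_eq_nonneg_coord]
  rfl

theorem mem_interior_body {x : E3} :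
    x ∈ interior T.body ↔ ∀ i, 0 < T.affineBasis.coord i x := by
  have : T.body = convexHull ℝ (range T.affineBasis) := rfl
  rw [this, AffineBasis.interior_convexHull]
  rfl

theorem points_mem_body (j : Fin 4) : T.points j ∈ T.body :=
  subset_convexHull ℝ _ (mem_range_self j)

theorem points_mem_extremePoints (j : Fin 4) : T.points j ∈ T.body.extremePoints ℝ := by
  refine ⟨T.points_mem_body j, fun x hx y hy hseg => ?_⟩
  obtain ⟨s, t, hs, ht, hst, hj⟩ := hseg
  have h0 : ∀ i, i ≠ j → T.affineBasis.coord i x = 0 := by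
    intro i hij
    have h1 := T.coord_combo hst x y i
    rw [hj, T.coord_points, if_neg hij] at h1
    have h2 := T.mem_body.1 hx i
    have h3 := mul_nonneg ht.le (T.mem_body.1 hy i)
    have h4 : s * T.affineBasis.coord i x = 0 := by
      have := mul_nonneg hs.le h2
      linarith
    exact (mul_eq_zero.1 h4).resolve_left hs.ne'
  refine T.affineBasis.ext_elem fun i => ?_
  rw [T.coord_points]
  split_ifs with hij
  · subst hij
    rw [← T.affineBasis.sum_coord_apply_eq_one x, Finset.sum_eq_single i (fun k _ hk => h0 k hk)
      (by simp)]
  · exact h0 i hij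

theorem isCompact_body : IsCompact T.body := Set.Finite.isCompact_convexHull ℝ (finite_range _)

theorem interior_body_nonempty : (interior T.body).Nonempty :=
  interior_convexHull_nonempty_iff_affineSpan_eq_top.2 T.affineSpan_points

end Tetrahedron

/-! ### Local finiteness and neighbours across a facet -/

section Neighbour

variable {T : Tetrahedron} {𝒯 : Set (Set E3)}

theorem image_ball_isometry (g : E3 ≃ᵃⁱ[ℝ] E3) (x : E3) (r : ℝ) :
    g '' Metric.ball x r = Metric.ball (g x) r :=
  g.toIsometryEquiv.image_ball x r

theorem image_closedBall_isometry (g : E3 ≃ᵃⁱ[ℝ] E3) (x : E3) (r : ℝ) :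
    g '' Metric.closedBall x r = Metric.closedBall (g x) r :=
  g.toIsometryEquiv.image_closedBall x r

/-- A volume count: the tiles contain disjoint balls of one fixed radius, all within a bounded
region. -/
theorem IsFaceToFaceTiling.finite_meeting_ball (h : IsFaceToFaceTiling T 𝒯) (x : E3) :
    {L ∈ 𝒯 | (L ∩ Metric.closedBall x 1).Nonempty}.Finite := by
  obtain ⟨c, hc⟩ := T.interior_body_nonempty
  obtain ⟨r, hr, hball⟩ := Metric.isOpen_iff.1 isOpen_interior c hc
  obtain ⟨R, hR⟩ := T.isCompact_body.isBounded.subset_closedBall c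
  choose φ hφ using h.congruent
  let S := {L ∈ 𝒯 | (L ∩ Metric.closedBall x 1).Nonempty}
  let As : S → Set E3 := fun L => Metric.ball (φ L.1 L.2.1 c) r
  have hsub : ∀ L : S, As L ⊆ interior L.1 := by
    intro L
    refine interior_maximal ?_ Metric.isOpen_ball
    have h1 := image_mono (f := φ L.1 L.2.1) (hball.trans interior_subset)
    rwa [image_ball_isometry, hφ] at h1
  have hbig : ∀ L : S, As L ⊆ Metric.closedBall x (2 * R + 1) := by
    intro L y hy
    have hL : L.1 ⊆ Metric.closedBall (φ L.1 L.2.1 c) R := by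
      have h1 := image_mono (f := φ L.1 L.2.1) hR
      rwa [image_closedBall_isometry, hφ] at h1
    obtain ⟨z, hzL, hzx⟩ := L.2.2
    have h1 := hL (interior_subset (hsub L hy))
    have h2 := hL hzL
    rw [Metric.mem_closedBall] at *
    have h3 := dist_triangle y (φ L.1 L.2.1 c) x
    have h4 := dist_triangle (φ L.1 L.2.1 c) z x
    rw [dist_comm _ z] at h4
    linarith
  have hdisj : Pairwise (Function.onFun Disjoint As) := by
    intro L M hne
    exact (h.disjoint_interior _ L.2.1 _ M.2.1 (fun e => hne (Subtype.ext e))).mono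
      (hsub L) (hsub M)
  have hfin := MeasureTheory.Measure.finite_const_le_meas_of_disjoint_iUnion
    (MeasureTheory.volume : MeasureTheory.Measure E3)
    (ε := MeasureTheory.volume (Metric.ball (0 : E3) r)) (Metric.measure_ball_pos _ _ hr)
    (As := As) (fun _ => measurableSet_ball) hdisj
    (ne_top_of_le_ne_top (isCompact_closedBall x (2 * R + 1)).measure_lt_top.ne
      (MeasureTheory.measure_mono (iUnion_subset hbig)))
  have huniv : {L : S | MeasureTheory.volume (Metric.ball (0 : E3) r)
      ≤ MeasureTheory.volume (As L)} = univ := by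
    refine eq_univ_of_forall fun L => ?_
    exact (MeasureTheory.Measure.addHaar_ball_center MeasureTheory.volume
      (φ L.1 L.2.1 c) r).ge
  rw [huniv, finite_univ_iff] at hfin
  exact S.toFinite

/-- By local finiteness the other tiles near `x` have a closed union. If it missed `x`, points
outside `K` close to `x` would be uncovered. -/
theorem IsFaceToFaceTiling.exists_ne_mem (h : IsFaceToFaceTiling T 𝒯) {K : Set E3} {x : E3}
    (hx : x ∉ interior K) : ∃ L ∈ 𝒯, L ≠ K ∧ x ∈ L := by
  by_contra! hno
  have hcl : x ∈ closure Kᶜ := by rwa [closure_compl, mem_compl_iff]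
  let S := {L ∈ 𝒯 | (L ∩ Metric.closedBall x 1).Nonempty} \ {K}
  have hS : S.Finite := (h.finite_meeting_ball x).sdiff
  have hclosed : IsClosed (⋃₀ S) := by
    rw [sUnion_eq_biUnion]
    refine Set.Finite.isClosed_biUnion hS fun L hL => ?_
    obtain ⟨φ, rfl⟩ := h.congruent L hL.1.1
    exact (T.isCompact_body.image φ.continuous).isClosed
  have hxS : x ∉ ⋃₀ S := by
    rintro ⟨L, hL, hxL⟩
    exact hno L hL.1.1 hL.2 hxL
  have hnhds : (⋃₀ S)ᶜ ∩ Metric.ball x 1 ∈ nhds x :=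
    Filter.inter_mem (hclosed.isOpen_compl.mem_nhds hxS) (Metric.ball_mem_nhds x one_pos)
  obtain ⟨y, ⟨hyS, hyb⟩, hyK⟩ := mem_closure_iff_nhds.1 hcl _ hnhds
  obtain ⟨L, hL, hyL⟩ : y ∈ ⋃₀ 𝒯 := by rw [h.cover]; trivial
  exact hyS ⟨L, ⟨⟨hL, y, hyL, Metric.ball_subset_closedBall hyb⟩,
    fun e => hyK (mem_singleton_iff.1 e ▸ hyL)⟩, hyL⟩

/-- In an orientation-preserving face-to-face tiling, the neighbour of a tile across a facet is
the image of that tile under an orientation-preserving isometry that maps three vertices of the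
tile to the vertices of the facet. -/
theorem IsFaceToFaceTiling.exists_neighbour (h : IsFaceToFaceTiling T 𝒯)
    (ho : IsOrientationPreserving 𝒯) {k : Fin 4} {e : Fin 3 → Fin 4} (he : ∀ m, e m ≠ k) :
    ∃ χ : E3 ≃ᵃⁱ[ℝ] E3, IsDirectIsometry χ ∧ χ '' T.body ≠ T.body ∧
      ∀ m, ∃ i, χ (T.points i) = T.points (e m) := by
  obtain ⟨K, hK, -⟩ : (0 : E3) ∈ ⋃₀ 𝒯 := by rw [h.cover]; trivial
  obtain ⟨φ, hφ⟩ := h.congruent K hK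
  -- For the injective `e` used later, this is the centroid of the facet: any face of the tile
  -- containing it contains all three facet vertices.
  set c : E3 := (1 / 3 : ℝ) • T.points (e 0) +
    (2 / 3 : ℝ) • ((1 / 2 : ℝ) • T.points (e 1) + (1 / 2 : ℝ) • T.points (e 2)) with hc
  have hcB : c ∈ T.body := by
    have hconv := convex_convexHull ℝ (range T.points)
    refine hconv (T.points_mem_body _) (hconv (T.points_mem_body _) (T.points_mem_body _)
      ?_ ?_ ?_) ?_ ?_ ?_ <;> norm_num
  have hcint : c ∉ interior T.body := by
    intro hmem
    have h1 := T.mem_interior_body.1 hmem k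
    rw [hc, T.coord_combo (by norm_num), T.coord_combo (by norm_num), T.coord_points,
      T.coord_points, T.coord_points, if_neg (he 0).symm, if_neg (he 1).symm,
      if_neg (he 2).symm] at h1
    norm_num at h1
  have hxK : φ c ∉ interior K := by
    rw [← hφ]
    intro hmem
    have h1 : interior (φ '' T.body) = φ '' interior T.body :=
      (φ.toHomeomorph.image_interior T.body).symm
    rw [h1, φ.injective.mem_set_image] at hmem
    exact hcint hmem
  obtain ⟨L, hL, hne, hxL⟩ := h.exists_ne_mem hxK
  obtain ⟨ψ, hψ, hψL⟩ := ho K hK L hL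
  set χ := φ⁻¹ * ψ * φ with hχ
  have hχL : φ '' (χ '' T.body) = L := by
    rw [← image_mul_eq, hχ, show φ * (φ⁻¹ * ψ * φ) = ψ * φ by group, image_mul_eq, hφ, hψL]
  have hback : ∀ S : Set E3, ⇑(φ⁻¹) '' (φ '' S) = S := fun S => by
    rw [← image_mul_eq, inv_mul_cancel, AffineIsometryEquiv.coe_one, image_id]
  have hcχ : c ∈ χ '' T.body := by
    rw [← φ.injective.mem_set_image, hχL]; exact hxL
  have hinter : ⇑(φ⁻¹) '' (K ∩ L) = T.body ∩ χ '' T.body := by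
    rw [← hφ, ← hχL, ← image_inter φ.injective, hback]
  have hf := h.face_to_face K hK L hL
  have hext1 : IsExtreme ℝ T.body (T.body ∩ χ '' T.body) := by
    have := hf.1.2.image_isometry φ⁻¹
    rwa [hinter, ← hφ, hback] at this
  have hext2 : IsExtreme ℝ (χ '' T.body) (T.body ∩ χ '' T.body) := by
    have := hf.2.2.image_isometry φ⁻¹
    rwa [hinter, ← hχL, hback] at this
  refine ⟨χ, ?_, ?_, fun m => ?_⟩
  · have := hψ.conj φ⁻¹
    rwa [inv_inv] at this
  · intro heq
    rw [heq, hφ] at hχL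
    exact hne hχL.symm
  · have hseg : ∃ q ∈ T.body, c ∈ openSegment ℝ (T.points (e m)) q := by
      have hmid : ∀ i j, (1 / 2 : ℝ) • T.points i + (1 / 2 : ℝ) • T.points j ∈ T.body :=
        fun i j => convex_convexHull ℝ (range T.points) (T.points_mem_body i)
          (T.points_mem_body j) (by norm_num) (by norm_num) (by norm_num)
      fin_cases m
      · exact ⟨_, hmid (e 1) (e 2), 1 / 3, 2 / 3, by norm_num, by norm_num, by norm_num, rfl⟩
      · exact ⟨_, hmid (e 0) (e 2), 1 / 3, 2 / 3, by norm_num, by norm_num, by norm_num, by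
          simp only [hc]; simp; module⟩
      · exact ⟨_, hmid (e 0) (e 1), 1 / 3, 2 / 3, by norm_num, by norm_num, by norm_num, by
          simp only [hc]; simp; module⟩
    obtain ⟨q, hq, hcq⟩ := hseg
    have hmem := hext1.left_mem_of_mem_openSegment (T.points_mem_body (e m)) hq ⟨hcB, hcχ⟩ hcq
    -- The vertex is extreme in the tile, hence in the common face, hence by transitivity in the
    -- neighbour, so it is a vertex of the neighbour.
    have h1 : IsExtreme ℝ T.body {T.points (e m)} :=
      isExtreme_singleton.2 (T.points_mem_extremePoints _)
    have h2 := hext2.trans (h1.mono inter_subset_left (singleton_subset_iff.2 hmem))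
    have h3 := h2.image_isometry χ⁻¹
    rw [← image_mul_eq, inv_mul_cancel, AffineIsometryEquiv.coe_one, image_id,
      image_singleton] at h3
    obtain ⟨i, hi⟩ := extremePoints_convexHull_subset h3.mem_extremePoints
    exact ⟨i, by rw [hi]; exact χ.apply_symm_apply _⟩

end Neighbour

/-! ### Rigidity of direct isometries and the need for reflected copies -/

theorem LinearIsometryEquiv.apply_eq_of_det_pos {A : E3 ≃ₗᵢ[ℝ] E3}
    (hA : 0 < LinearMap.det (A.toLinearEquiv : E3 →ₗ[ℝ] E3)) {u v w : E3}
    (hli : LinearIndependent ℝ ![u, v, w]) (hu : A u = u) (hv : A v = v) : A w = w := by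
  let B := basisOfLinearIndependentOfCardEqFinrank hli (by simp)
  have hB : ∀ i, B i = ![u, v, w] i := fun i => by simp [B]
  have hB0 : B 0 = u := hB 0
  have hB1 : B 1 = v := hB 1
  have hB2 : B 2 = w := hB 2
  -- The matrix of `A` is unitriangular except for this entry `t > 0`. The displacement `δ = A w -
  -- w` is orthogonal to `u` and `v`, and preservation of `‖w‖` gives `‖δ‖² (t + 1) = 0`.
  have hdet : LinearMap.det (A.toLinearEquiv : E3 →ₗ[ℝ] E3) = B.repr (A w) 2 := by
    rw [← LinearMap.det_toMatrix B, Matrix.det_fin_three]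
    have e0 : A (B 0) = B 0 := by rw [hB0, hu]
    have e1 : A (B 1) = B 1 := by rw [hB1, hv]
    simp [LinearMap.toMatrix_apply, e0, e1, hB2]
  rw [hdet] at hA
  have hexp : A w = B.repr (A w) 0 • u + B.repr (A w) 1 • v + B.repr (A w) 2 • w := by
    conv_lhs => rw [← B.sum_repr (A w), Fin.sum_univ_three, hB0, hB1, hB2]
  set r := B.repr (A w) 0
  set s := B.repr (A w) 1
  set t := B.repr (A w) 2
  obtain ⟨δ, hδ⟩ : ∃ δ, δ = A w - w := ⟨_, rfl⟩
  have hAw : A w = w + δ := by rw [hδ]; abel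
  have hδu : inner ℝ u δ = 0 := by
    have := A.inner_map_map u w
    rw [hu] at this
    rw [hδ, inner_sub_right, this, sub_self]
  have hδv : inner ℝ v δ = 0 := by
    have := A.inner_map_map v w
    rw [hv] at this
    rw [hδ, inner_sub_right, this, sub_self]
  have h1 : inner ℝ δ δ = (t - 1) * inner ℝ w δ := by
    have : δ = r • u + s • v + (t - 1) • w := by rw [hδ, hexp]; module
    have h := congrArg (fun x => inner ℝ x δ) this
    simp only [inner_add_left, real_inner_smul_left, hδu, hδv] at h
    linarith
  have h2 : 2 * inner ℝ w δ + inner ℝ δ δ = 0 := by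
    have := A.inner_map_map w w
    rw [hAw, inner_add_left, inner_add_right, inner_add_right, real_inner_comm w δ] at this
    linarith
  have h3 : inner ℝ δ δ * (t + 1) = 0 := by
    have : inner ℝ w δ = - inner ℝ δ δ / 2 := by linarith
    rw [this] at h1
    linarith
  have h4 : δ = 0 := by
    rw [mul_eq_zero, inner_self_eq_zero] at h3
    exact h3.resolve_right (by linarith)
  rw [hAw, h4, add_zero]

namespace Tetrahedron

variable {T : Tetrahedron}

theorem image_body_of_fixes_facet {χ : E3 ≃ᵃⁱ[ℝ] E3} (hχ : IsDirectIsometry χ) {i j l k : Fin 4}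
    (hijlk : ∀ m, m = i ∨ m = j ∨ m = l ∨ m = k) (hi : χ (T.points i) = T.points i)
    (hj : χ (T.points j) = T.points j) (hl : χ (T.points l) = T.points l) :
    χ '' T.body = T.body := by
  have hli : LinearIndependent ℝ ![T.points j - T.points i, T.points l - T.points i,
      T.points k - T.points i] := by
    refine linearIndependent_of_top_le_span_of_card_eq_finrank ?_ (by simp)
    have h1 : vectorSpan ℝ (range T.points) = ⊤ := by
      rw [← direction_affineSpan, T.affineSpan_points, AffineSubspace.direction_top]
    rw [← h1, vectorSpan_range_eq_span_range_vsub_right ℝ T.points i, Submodule.span_le]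
    rintro _ ⟨m, rfl⟩
    change T.points m - T.points i ∈ _
    rcases hijlk m with rfl | rfl | rfl | rfl
    · simp
    · exact Submodule.subset_span ⟨0, rfl⟩
    · exact Submodule.subset_span ⟨1, rfl⟩
    · exact Submodule.subset_span ⟨2, rfl⟩
  have hlin : ∀ x y, χ.linearIsometryEquiv (x - y) = χ x - χ y := fun x y => χ.map_vsub x y
  have hk := LinearIsometryEquiv.apply_eq_of_det_pos hχ hli (by rw [hlin, hi, hj])
    (by rw [hlin, hi, hl])
  rw [hlin, hi, sub_left_inj] at hk
  have hall : ∀ m, χ (T.points m) = T.points m := by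
    intro m
    rcases hijlk m with rfl | rfl | rfl | rfl <;> assumption
  have h2 : χ '' T.body = convexHull ℝ (χ '' range T.points) :=
    (χ.toAffineEquiv : E3 →ᵃ[ℝ] E3).image_convexHull _
  rw [h2, ← range_comp]
  have h3 : χ ∘ T.points = T.points := funext hall
  rw [h3, body]

theorem IsGoldbergFirst.not_isOrientationPreserving {a b c : ℝ} (h : T.IsGoldbergFirst a b c)
    (hab : a ≠ b) (hac : a ≠ c) {𝒯 : Set (Set E3)} (h𝒯 : IsFaceToFaceTiling T 𝒯) :
    ¬ IsOrientationPreserving 𝒯 := by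
  intro ho
  have hpos : ∀ i j, i ≠ j → 0 < dist (T.points i) (T.points j) := fun i j hij =>
    dist_pos.2 (T.independent.injective.ne hij)
  have ha : 0 < a := h.len14 ▸ hpos 0 3 (by decide)
  have hb : 0 < b := h.len12 ▸ hpos 0 1 (by decide)
  have hc : 0 < c := h.len13 ▸ hpos 0 2 (by decide)
  have hbc : b ≠ c := by
    rintro rfl
    have := h.rel
    have := pow_pos ha 2
    linarith
  have hM : ∀ i j, dist (T.points i) (T.points j) =
      ![![0, b, c, a], ![b, 0, b, c], ![c, b, 0, b], ![a, c, b, 0]] i j := by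
    have l01 : dist (T.points 0) (T.points 1) = b := h.len12
    have l02 : dist (T.points 0) (T.points 2) = c := h.len13
    have l03 : dist (T.points 0) (T.points 3) = a := h.len14
    have l12 : dist (T.points 1) (T.points 2) = b := h.len23
    have l13 : dist (T.points 1) (T.points 3) = c := h.len24
    have l23 : dist (T.points 2) (T.points 3) = b := h.len34
    intro i j
    fin_cases i <;> fin_cases j <;> simp [l01, l02, l03, l12, l13, l23] <;>
      rw [dist_comm] <;> assumption
  -- This facet has the distinct edge lengths `a`, `b`, `c`. Only one edge of `T` has length `a`, so
  -- the glued facet is this one or its image under the half-turn.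
  obtain ⟨χ, hχ, hne, hv⟩ := h𝒯.exists_neighbour ho (k := 2) (e := ![0, 1, 3]) (by decide)
  obtain ⟨i, hi⟩ := hv 0
  obtain ⟨j, hj⟩ := hv 1
  obtain ⟨l, hl⟩ := hv 2
  simp only [Matrix.cons_val] at hi hj hl
  have hd : ∀ x y, dist (χ x) (χ y) = dist x y := χ.dist_map
  have dil : dist (T.points i) (T.points l) = a := by rw [← hd, hi, hl]; exact h.len14
  have dij : dist (T.points i) (T.points j) = b := by rw [← hd, hi, hj]; exact h.len12
  rw [hM] at dil dij
  have hcases : (i = 0 ∧ j = 1 ∧ l = 3) ∨ (i = 3 ∧ j = 2 ∧ l = 0) := by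
    have hil : (i = 0 ∧ l = 3) ∨ (i = 3 ∧ l = 0) := by
      clear dij hi hj hl
      fin_cases i <;> fin_cases l <;> simp at dil ⊢ <;>
        first | exact ha.ne dil | exact hab dil.symm | exact hac dil.symm
    clear hi hj hl dil
    rcases hil with ⟨rfl, rfl⟩ | ⟨rfl, rfl⟩ <;> fin_cases j <;> simp at dij ⊢ <;>
      first | exact hb.ne dij | exact hbc dij.symm | exact hab dij
  rcases hcases with ⟨rfl, rfl, rfl⟩ | ⟨rfl, rfl, rfl⟩
  · exact hne (image_body_of_fixes_facet (k := 2) hχ (by decide) hi hj hl)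
  · obtain ⟨F, hF⟩ := h.exists_frame
    obtain ⟨ρ, hρ, hρv, -⟩ := F.exists_halfTurn
    have hρp : ∀ k, ρ (T.points k) = T.points k.rev := fun k => by rw [← hF, ← hF, hρv]
    have hρB : ρ '' T.body = T.body := by
      have h2 : ρ '' T.body = convexHull ℝ (ρ '' range T.points) :=
        (ρ.toAffineEquiv : E3 →ᵃ[ℝ] E3).image_convexHull _
      rw [h2, ← range_comp, show ρ ∘ T.points = T.points ∘ Fin.rev from funext hρp,
        Fin.rev_surjective.range_comp, body]
    -- Composing with the half-turn `ρ`, which preserves the tile, reduces to the case of a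
    -- pointwise fixed facet.
    have hfix := image_body_of_fixes_facet (T := T) (i := 0) (j := 1) (l := 3) (k := 2)
      (hχ.mul hρ) (by decide) (by simpa [hρp] using hi) (by simpa [hρp] using hj)
      (by simpa [hρp] using hl)
    rw [image_mul_eq, hρB] at hfix
    exact hne hfix

theorem IsGoldbergSecond.not_isOrientationPreserving {a b c d : ℝ}
    (h : T.IsGoldbergSecond a b c d) (had : a ≠ 2 * d) {𝒯 : Set (Set E3)}
    (h𝒯 : IsFaceToFaceTiling T 𝒯) : ¬ IsOrientationPreserving 𝒯 := by
  intro ho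
  have hpos : ∀ i j, i ≠ j → 0 < dist (T.points i) (T.points j) := fun i j hij =>
    dist_pos.2 (T.independent.injective.ne hij)
  have ha : 0 < a / 2 := h.len14 ▸ hpos 0 3 (by decide)
  have hd0 : 0 < d := h.len24 ▸ hpos 1 3 (by decide)
  have hc : 0 < c := h.len13 ▸ hpos 0 2 (by decide)
  have ha2 : 0 < a ^ 2 := pow_pos (by linarith) 2
  have r1 := h.rel₁
  have r2 := h.rel₂
  have hbc : b ≠ c := by rintro rfl; linarith
  have hdc : d ≠ c := by rintro rfl; linarith
  have hbd : b ≠ d := by rintro rfl; linarith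
  have hac : a / 2 ≠ c := by rintro rfl; nlinarith [sq_nonneg b]
  have had' : a / 2 ≠ d := fun e => had (by linarith)
  have hM : ∀ i j, dist (T.points i) (T.points j) =
      ![![0, b, c, a / 2], ![b, 0, b, d], ![c, b, 0, d], ![a / 2, d, d, 0]] i j := by
    have l01 : dist (T.points 0) (T.points 1) = b := h.len12
    have l02 : dist (T.points 0) (T.points 2) = c := h.len13
    have l03 : dist (T.points 0) (T.points 3) = a / 2 := h.len14
    have l12 : dist (T.points 1) (T.points 2) = b := h.len23
    have l13 : dist (T.points 1) (T.points 3) = d := h.len24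
    have l23 : dist (T.points 2) (T.points 3) = d := h.len34
    intro i j
    fin_cases i <;> fin_cases j <;> simp [l01, l02, l03, l12, l13, l23] <;>
      rw [dist_comm] <;> assumption
  -- This facet has the distinct edge lengths `c`, `a / 2`, `d`. Its edge of length `c` is the only
  -- one in `T`, and no other facet or labelling matches the remaining two lengths.
  obtain ⟨χ, hχ, hne, hv⟩ := h𝒯.exists_neighbour ho (k := 1) (e := ![0, 2, 3]) (by decide)
  obtain ⟨i, hi⟩ := hv 0
  obtain ⟨j, hj⟩ := hv 1
  obtain ⟨l, hl⟩ := hv 2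
  simp only [Matrix.cons_val] at hi hj hl
  have hd : ∀ x y, dist (χ x) (χ y) = dist x y := χ.dist_map
  have dij : dist (T.points i) (T.points j) = c := by rw [← hd, hi, hj]; exact h.len13
  have dil : dist (T.points i) (T.points l) = a / 2 := by rw [← hd, hi, hl]; exact h.len14
  have djl : dist (T.points j) (T.points l) = d := by rw [← hd, hj, hl]; exact h.len34
  rw [hM] at dij dil djl
  obtain ⟨rfl, rfl, rfl⟩ : i = 0 ∧ j = 2 ∧ l = 3 := by
    have hij : (i = 0 ∧ j = 2) ∨ (i = 2 ∧ j = 0) := by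
      clear dil djl hi hj hl
      fin_cases i <;> fin_cases j <;> simp at dij ⊢ <;>
        first | exact hc.ne dij | exact hbc dij | exact hac dij | exact hdc dij
    clear hi hj hl dij
    rcases hij with ⟨rfl, rfl⟩ | ⟨rfl, rfl⟩ <;> fin_cases l <;> simp at dil djl ⊢ <;>
      first
      | exact ha.ne dil
      | exact hd0.ne djl
      | exact hbd djl
      | exact had' djl
  exact hne (image_body_of_fixes_facet (k := 1) hχ (by decide) hi hj hl)

end Tetrahedron

/-! ### Existence of members of both families -/

theorem dist_eq_of_sum_sq {x y : E3} {r : ℝ} (hr : 0 ≤ r)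
    (h : (x 0 - y 0) ^ 2 + (x 1 - y 1) ^ 2 + (x 2 - y 2) ^ 2 = r ^ 2) : dist x y = r := by
  rw [EuclideanSpace.dist_eq, Fin.sum_univ_three]
  simp only [Real.dist_eq, sq_abs]
  rw [h, Real.sqrt_sq hr]

/-- The vertices of `helixTetrahedron`. -/
noncomputable def helixPoints (e h z : ℝ) : Fin 4 → E3 :=
  ![!₂[0, 0, 0], !₂[e, 0, h], !₂[e / 2, e * √3 / 2, 2 * h], !₂[0, 0, z]]

/-- Three successive vertices of a helix over an equilateral triangle of side `e`, rising by `h` at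
each step, and a point at height `z` above the first of them. -/
noncomputable def helixTetrahedron (e h z : ℝ) (he : e ≠ 0) (hz : z ≠ 0) : Tetrahedron where
  points := helixPoints e h z
  independent := by
    refine affineIndependent_of_sum_smul fun (w : Fin 4 → ℝ) hw hs => ?_
    replace hw : w 0 + w 1 + w 2 + w 3 = 0 := by rw [← Fin.sum_univ_four]; exact hw
    replace hs := (Fin.sum_univ_four fun i => w i • helixPoints e h z i).symm.trans hs
    have e0 := congrArg (fun x : E3 => x 0) hs
    have e1 := congrArg (fun x : E3 => x 1) hs
    have e2 := congrArg (fun x : E3 => x 2) hs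
    simp [helixPoints, he] at e0 e1 e2
    simp [e1, he] at e0
    simp [e0, e1, hz] at e2
    simp [e0, e1, e2] at hw
    intro i; fin_cases i <;> assumption

/-- Three helix steps of rise `a / 3` end at height `a` above the start. A step has length `b` when
the triangle has side `e` with `e² = b² - a² / 9`, which is positive because `a < 3 b`. -/
theorem exists_isGoldbergFirst {a b : ℝ} (ha : 0 < a) (hab : a < 3 * b) :
    ∃ (c : ℝ) (T : Tetrahedron), T.IsGoldbergFirst a b c := by
  have hb : 0 < b := by linarith
  have he : 0 < b ^ 2 - a ^ 2 / 9 := by nlinarith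
  have hc : 0 ≤ a ^ 2 / 3 + b ^ 2 := by positivity
  have s1 := Real.sq_sqrt he.le
  have s2 := Real.sq_sqrt hc
  have s3 : √3 ^ 2 = 3 := Real.sq_sqrt (by norm_num)
  have h0 : √(b ^ 2 - a ^ 2 / 9) ≠ 0 := (Real.sqrt_pos.2 he).ne'
  set e := √(b ^ 2 - a ^ 2 / 9)
  set c := √(a ^ 2 / 3 + b ^ 2)
  have hc0 : 0 ≤ c := Real.sqrt_nonneg _
  have s4 : (e * √3 / 2) ^ 2 = 3 / 4 * (b ^ 2 - a ^ 2 / 9) := by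
    rw [div_pow, mul_pow, s1, s3]; ring
  refine ⟨c, helixTetrahedron e (a / 3) a h0 ha.ne', s2.symm, ?_, ?_, ?_, ?_, ?_, ?_⟩ <;>
    refine dist_eq_of_sum_sq (by linarith) ?_ <;>
    simp [helixTetrahedron, helixPoints, -even_two] <;> ring_nf at s1 s2 s4 ⊢ <;> linarith

theorem exists_isGoldbergSecond {a b : ℝ} (ha : 0 < a) (hab : a < 3 * b) :
    ∃ (c d : ℝ) (T : Tetrahedron), T.IsGoldbergSecond a b c d := by
  have hb : 0 < b := by linarith
  have he : 0 < b ^ 2 - a ^ 2 / 9 := by nlinarith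
  have hd : 0 ≤ b ^ 2 - a ^ 2 / 12 := by nlinarith
  have hc : 0 ≤ a ^ 2 / 3 + b ^ 2 := by positivity
  have s1 := Real.sq_sqrt he.le
  have s2 := Real.sq_sqrt hc
  have s5 := Real.sq_sqrt hd
  have s3 : √3 ^ 2 = 3 := Real.sq_sqrt (by norm_num)
  have h0 : √(b ^ 2 - a ^ 2 / 9) ≠ 0 := (Real.sqrt_pos.2 he).ne'
  set e := √(b ^ 2 - a ^ 2 / 9)
  set c := √(a ^ 2 / 3 + b ^ 2)
  set d := √(b ^ 2 - a ^ 2 / 12)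
  have hc0 : 0 ≤ c := Real.sqrt_nonneg _
  have hd0 : 0 ≤ d := Real.sqrt_nonneg _
  have s4 : (e * √3 / 2) ^ 2 = 3 / 4 * (b ^ 2 - a ^ 2 / 9) := by
    rw [div_pow, mul_pow, s1, s3]; ring
  -- The same helix with the last vertex at height `a / 2`, the midpoint of the edge of length `a`.
  refine ⟨c, d, helixTetrahedron e (a / 3) (a / 2) h0 (by linarith), by linarith, s2.symm,
    ?_, ?_, ?_, ?_, ?_, ?_⟩ <;>
    refine dist_eq_of_sum_sq (by linarith) ?_ <;>
    simp [helixTetrahedron, helixPoints, -even_two] <;> ring_nf at s1 s2 s4 s5 ⊢ <;> linarith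

theorem proposition3p2 :
    -- both families have a member for all `a, b > 0` with `a < 3 b`
    (∀ a b : ℝ, 0 < a → a < 3 * b →
      (∃ (c : ℝ) (T : Tetrahedron), T.IsGoldbergFirst a b c) ∧
      (∃ (c d : ℝ) (T : Tetrahedron), T.IsGoldbergSecond a b c d)) ∧
    -- first family
    (∀ (a b c : ℝ) (T : Tetrahedron), T.IsGoldbergFirst a b c →
      (∃ 𝒯 : Set (Set E3), IsFaceToFaceTiling T 𝒯 ∧ IsAlternatingPrismDissection 𝒯) ∧
      (a ≠ b → a ≠ c →
        ∀ 𝒯 : Set (Set E3), IsFaceToFaceTiling T 𝒯 → ¬ IsOrientationPreserving 𝒯)) ∧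
    -- second family
    (∀ (a b c d : ℝ) (T : Tetrahedron), T.IsGoldbergSecond a b c d →
      (∃ 𝒯 : Set (Set E3), IsFaceToFaceTiling T 𝒯 ∧ IsAlternatingPrismDissection 𝒯) ∧
      (a ≠ 2 * d →
        ∀ 𝒯 : Set (Set E3), IsFaceToFaceTiling T 𝒯 → ¬ IsOrientationPreserving 𝒯)) :=

  ⟨fun _ _ ha hab => ⟨exists_isGoldbergFirst ha hab, exists_isGoldbergSecond ha hab⟩,
    fun _ _ _ _ h => ⟨h.exists_tiling, fun hab hac _ h𝒯 => h.not_isOrientationPreserving hab hac h𝒯⟩,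
    fun _ _ _ _ _ h => ⟨h.exists_tiling, fun had _ h𝒯 => h.not_isOrientationPreserving had h𝒯⟩⟩
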